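/- Let $N\ge 1$ and $s\in(0,1)$ be fixed, let $c_s=(1-s)/\omega_{N-1}$ with $\omega_{N-1}$ the volume of the unit ball of $\mathbb R^{N-1}$ ($\omega_0=1$), and for a Lebesgue measurable $F\subseteq\mathbb R^N$ let $$\mathcal P_s(F)=c_s\int_F\int_{F^c}\frac{dx\,dy}{|x-y|^{N+s}} .$$ For $h,R>0$ let $T_h(\overline B_R)$ be the maximal solution (the minimizer which contains every other minimizer up to null sets, represented by its points of density $1$) of $$\min_{F\ \text{Lebesgue measurable}}\Big\{\mathcal P_s(F)+\frac1h\int_F(|x|-R)\,dx\Big\}.$$ For $\rho>0$ let $\kappa_s^\rho$ be the fractional curvature of the ball $B_\rho$, i.e. the value, the same for all $x\in\partial B_\rho$, of $$c_s\,\mathrm{P.V.}\int_{\mathbb R^N}\frac{\chi_{B_\rho^c}(y)-\chi_{B_\rho}(y)}{|x-y|^{N+s}}\,dy .$$ For $h>0$ let $\phi^h$ be the Lipschitz function $u:\mathbb R^N\to\mathbb R$ with $u(x)\to+\infty$ as $|x|\to\infty$ for which there is $z\in L^\infty(\mathbb R^N\times\mathbb R^N)$ with $\|z\|_\infty\le1$,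 $z(x,y)(u(x)-u(y))=|u(x)-u(y)|$ for a.e. $(x,y)$, and $$h\,\frac{c_s}{2}\int_{\mathbb R^N}\int_{\mathbb R^N}z(x,y)\frac{\psi(x)-\psi(y)}{|x-y|^{N+s}}\,dx\,dy+\int_{\mathbb R^N}u\,\psi\,dx=\int_{\mathbb R^N}|x|\,\psi(x)\,dx\qquad\text{for all }\psi\in C_c^\infty(\mathbb R^N).$$ Then the curvatures $\kappa_s^\rho$ are well defined, and the following holds. 1. For every $\delta>0$ there is $h_0=h_0(s,\delta)>0$ such that for every $h\in(0,h_0)$ and every $R\ge\delta$ the maximal solution $T_h(\overline B_R)$ exists and $$T_h(\overline B_R)\supseteq\overline B_{R-\kappa_s^{\delta/2}h}.$$ Moreover, with $c_0=\kappa_s^{\delta/2}$ and for every $h\in(0,h_0)$, a function $\phi^h$ as above exists, and every such function satisfies $\phi^h(x)\le|x|+c_0h$ for all $x\in\mathbb R^N$ with $|x|+c_0h\ge\delta$. 2. For every $\alpha\in(0,1/(N+1))$ there is $h_1=h_1(\alpha)>0$ such that for every $h\in(0,h_1]$ a function $\phi^h$ as above exists, and every such function satisfies $\phi^h(0)\le2h^\alpha$.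 -/

import Mathlib

open MeasureTheory Filter Topology

namespace FracFlow

noncomputable section

/-- Euclidean space `ℝ^N` with the Euclidean norm and Lebesgue measure. -/
abbrev Euc (N : ℕ) : Type := EuclideanSpace ℝ (Fin N)

/-- The normalizing constant `c_s = (1 - s) / ω_{N-1}`, where `ω_{N-1}` is the volume of the unit
ball of `ℝ^{N-1}` (so `ω_0 = 1`). -/
def cs (N : ℕ) (s : ℝ) : ℝ :=
  (1 - s) / (volume (Metric.ball (0 : Euc (N - 1)) 1)).toReal

/-- The `s`-fractional perimeter
`P_s(E) = c_s ∫_E ∫_{E^c} |x - y|^{-(N+s)} dy dx ∈ [0, ∞]`. -/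
def perimeter {N : ℕ} (s : ℝ) (E : Set (Euc N)) : ENNReal :=
  ENNReal.ofReal (cs N s) *
    ∫⁻ x in E, ∫⁻ y in Eᶜ, ENNReal.ofReal (1 / ‖x - y‖ ^ ((N : ℝ) + s))

/-- The integral `∫_F g dx` as an extended real number (positive part minus negative part). It is
used only for `g` with `∫ g⁻ < ∞`, so that `∞ - ∞` does not occur. -/
def extIntegral {N : ℕ} (F : Set (Euc N)) (g : Euc N → ℝ) : EReal :=
  ((∫⁻ x in F, ENNReal.ofReal (g x) : ENNReal) : EReal)
    - ((∫⁻ x in F, ENNReal.ofReal (- g x) : ENNReal) : EReal)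

/-- The energy `P_s(F) + (1/h) ∫_F (|x| - R) dx`; note that `|x| - R` is the signed distance
function of the closed ball of radius `R`. -/
def ballEnergy {N : ℕ} (s h R : ℝ) (F : Set (Euc N)) : EReal :=
  (perimeter s F : EReal) + ((1 / h : ℝ) : EReal) * extIntegral F (fun x => ‖x‖ - R)

/-- `F` minimizes `P_s(F) + (1/h) ∫_F (|x| - R) dx` among all Lebesgue measurable sets. -/
def IsBallMinimizer {N : ℕ} (s h R : ℝ) (F : Set (Euc N)) : Prop :=
  NullMeasurableSet F volume ∧
    ∀ G : Set (Euc N), NullMeasurableSet G volume → ballEnergy s h R F ≤ ballEnergy s h R G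

/-- `T` is the maximal solution of the minimum problem: a minimizer that contains, up to Lebesgue
null sets, every minimizer. Such a `T` is unique up to null sets; its precise representative
`densityOne T` is the set `T_h(B̄_R)`. -/
def IsMaximalSolution {N : ℕ} (s h R : ℝ) (T : Set (Euc N)) : Prop :=
  IsBallMinimizer s h R T ∧
    ∀ G : Set (Euc N), IsBallMinimizer s h R G → volume (G \ T) = 0

/-- The precise representative of a measurable set: its points of density one. -/
def densityOne {N : ℕ} (A : Set (Euc N)) : Set (Euc N) :=
  {x | Tendsto (fun ρ : ℝ => volume (A ∩ Metric.ball x ρ) / volume (Metric.ball x ρ))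
    (𝓝[>] 0) (𝓝 1)}

/-- The `s`-fractional curvature of `E` at `x` exists as a principal value and equals `k`:
`k = c_s lim_{ε → 0⁺} ∫_{|x - y| ≥ ε} (χ_{E^c}(y) - χ_E(y)) / |x - y|^{N+s} dy`. -/
def HasCurvature {N : ℕ} (s : ℝ) (E : Set (Euc N)) (x : Euc N) (k : ℝ) : Prop :=
  Tendsto
    (fun ε : ℝ => cs N s * ∫ y in (Metric.ball x ε)ᶜ,
      (Eᶜ.indicator (fun _ => (1 : ℝ)) y - E.indicator (fun _ => (1 : ℝ)) y)
        / ‖x - y‖ ^ ((N : ℝ) + s))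
    (𝓝[>] 0) (𝓝 k)

/-- The nonlocal divergence of `z ∈ L^∞(ℝ^N × ℝ^N)`, as a distribution:
`⟨div_s z, ψ⟩ = -(c_s / 2) ∫∫ z(x,y) (ψ(x) - ψ(y)) / |x - y|^{N+s} dx dy`. -/
def divPairing {N : ℕ} (s : ℝ) (z : Euc N × Euc N → ℝ) (ψ : Euc N → ℝ) : ℝ :=
  - (cs N s / 2 * ∫ p : Euc N × Euc N, z p * ((ψ p.1 - ψ p.2) / ‖p.1 - p.2‖ ^ ((N : ℝ) + s)))

/-- The class `𝓛⁺` of Lipschitz functions that tend to `+∞` as `|x| → ∞`. -/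
def LPlus (N : ℕ) : Set (Euc N → ℝ) :=
  {g | (∃ K : NNReal, LipschitzWith K g) ∧ Tendsto g (cocompact (Euc N)) atTop}

/-- `u` is the solution `u_h^g` of the fractional ROF problem with datum `g ∈ 𝓛⁺`:
`u ∈ 𝓛⁺`, and there is `z ∈ L^∞(ℝ^N × ℝ^N)` with `‖z‖_∞ ≤ 1`,
`z(x,y) (u(x) - u(y)) = |u(x) - u(y)|` for a.e. `(x,y)`, and
`-h div_s z + u = g` in the sense of distributions on `ℝ^N`. -/
def IsROFSolution {N : ℕ} (s h : ℝ) (g u : Euc N → ℝ) : Prop :=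
  u ∈ LPlus N ∧
  ∃ z : Euc N × Euc N → ℝ,
    AEStronglyMeasurable z volume ∧
    (∀ᵐ p : Euc N × Euc N, |z p| ≤ 1) ∧
    (∀ᵐ p : Euc N × Euc N, z p * (u p.1 - u p.2) = |u p.1 - u p.2|) ∧
    ∀ ψ : Euc N → ℝ, ContDiff ℝ (⊤ : ℕ∞) ψ → HasCompactSupport ψ →
      - h * divPairing s z ψ + ∫ x, u x * ψ x = ∫ x, g x * ψ x

end

end FracFlow

namespace FracFlow

/-! The proof reduces everything to one function `u`, the solution of the ROF problem with datum
`|x|`, and reads both claims off its sublevel sets and its values.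

Existence. The sign of `u(x) - u(y)` is replaced by a saturated multiple `sat (ν (u(x) - u(y)))` and
the kernel is cut off near the diagonal. The resulting equation is solved by a monotone iteration
(`exists_regularized`) started at `|x|`, which is a subsolution because the norm is convex. The
iteration preserves order and the Lipschitz constant 1. Testing with a hat function gives a bound
uniform in the regularization, so compactness (pointwise for `u`, weak for the field `z`) produces a
solution that is 1-Lipschitz, lies above `|x|`, and satisfies the calibration inequality `∫_F (u -
|x|) ≤ h P_s(F)` (`exists_calibratedSol`). A comparison principle (`WeakSol.le`) makes it the only
solution.

Minimizers. Testing with ramps of `u` gives `P_s({u ≤ R}) ≤ (1/h) ∫_{u ≤ R} (u - |x|)`. Together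
with the calibration inequality, this bounds the energy of any `F` below by `(1/h) ∫_F (u - R)` and
that of `{u ≤ R}` above by the same expression. Among all sets, `{u ≤ R}` minimizes this integral
and is the largest to do so (`CalibratedSol.isMaximalSolution`).

Upper bound. The function `b + max |x| a` is aligned with the field `sign(|x| - |y|)`, whose
divergence is controlled by the curvature of balls. Pairing `v` with `-v` turns the principal value
into the integral of the kernel over a set that shrinks as the radius grows, so the curvature is
finite and decreasing. Comparison then gives `u ≤ |x| + κ h` away from the origin
(`WeakSol.le_max`). Using the curvature at radius `5δ/8`, strictly below that at `δ/2`, places the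
closed ball in the open set `{u < R}`, hence among the density points.

Value at the origin. A hat function of radius `r` gives `u(0) ≤ 2r + A h / r`. The choice `r = h^α /
2` works for every `α < 1/2`, and `1/(N+1) ≤ 1/2`. -/

/-- The kernel `|v|^{-(N+s)}`. -/
noncomputable def ker {N : ℕ} (s : ℝ) (v : Euc N) : ℝ := 1 / ‖v‖ ^ ((N : ℝ) + s)

/-- The kernel `|v|^{-(N+s)}` restricted to `|v| ≥ ε`. -/
noncomputable def kerTrunc {N : ℕ} (s ε : ℝ) (v : Euc N) : ℝ := {v : Euc N | ε ≤ ‖v‖}.indicator (ker s) v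

/-- The weighted difference quotient `(ψ(x) - ψ(y)) / |x - y|^{N+s}`. -/
noncomputable def dq {N : ℕ} (s : ℝ) (ψ : Euc N → ℝ) (p : Euc N × Euc N) : ℝ :=
  (ψ p.1 - ψ p.2) / ‖p.1 - p.2‖ ^ ((N : ℝ) + s)

/-- Lipschitz functions supported in `B̄_ρ`, with a bound on the oscillation. -/
structure IsTest {N : ℕ} (C ρ : ℝ) (ψ : Euc N → ℝ) : Prop where
  osc : ∀ x y, |ψ x - ψ y| ≤ C * min 1 ‖x - y‖
  supp : ∀ x, ρ < ‖x‖ → ψ x = 0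

/-! ### Integrability of the kernel and of its truncations -/

section kernel

variable {N : ℕ} {s : ℝ}

lemma ker_nonneg (v : Euc N) : 0 ≤ ker s v := by unfold ker; positivity

lemma ker_neg (v : Euc N) : ker s (-v) = ker s v := by simp [ker]

lemma measurable_ker : Measurable (ker s : Euc N → ℝ) := by
  unfold ker; fun_prop

lemma dq_eq (ψ : Euc N → ℝ) (p : Euc N × Euc N) :
    dq s ψ p = (ψ p.1 - ψ p.2) * ker s (p.1 - p.2) := by
  unfold dq ker; ring

lemma euc_nontrivial (hN : 1 ≤ N) : Nontrivial (Euc N) := by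
  have : Nonempty (Fin N) := ⟨⟨0, hN⟩⟩
  exact inferInstance

/-- In polar coordinates the radial density is `t^(-s)` on `(0,1)`, integrable because `s < 1`, and
`t^(-1-s)` beyond `1`, integrable because `s > 0`. -/
lemma integrable_min_ker (hN : 1 ≤ N) (hs0 : 0 < s) (hs1 : s < 1) :
    Integrable (fun v : Euc N => min 1 ‖v‖ * ker s v) := by
  have := euc_nontrivial hN
  have key := integrable_fun_norm_addHaar (volume : Measure (Euc N))
    (f := fun t : ℝ => min 1 t * (1 / t ^ ((N : ℝ) + s)))
  unfold ker
  refine key.2 ?_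
  have hfr : Module.finrank ℝ (Euc N) = N := by simp
  rw [hfr, ← Set.Ioo_union_Ici_eq_Ioi (zero_lt_one (α := ℝ)), integrableOn_union]
  have hcast : ((N - 1 : ℕ) : ℝ) = (N : ℝ) - 1 := by push_cast [hN]; ring
  constructor
  · have h1 : IntegrableOn (fun t : ℝ => t ^ (-s)) (Set.Ioo 0 1) :=
      (intervalIntegral.integrableOn_Ioo_rpow_iff zero_lt_one).2 (by linarith)
    refine h1.congr_fun (fun t ht => ?_) measurableSet_Ioo
    have ht0 : 0 < t := ht.1
    simp only [smul_eq_mul]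
    rw [min_eq_right ht.2.le, ← Real.rpow_natCast, hcast, one_div, ← Real.rpow_neg ht0.le]
    nth_rewrite 3 [← Real.rpow_one t]
    rw [← Real.rpow_add ht0, ← Real.rpow_add ht0]
    congr 1; ring
  · rw [integrableOn_Ici_iff_integrableOn_Ioi]
    have h1 : IntegrableOn (fun t : ℝ => t ^ (-1 - s)) (Set.Ioi 1) :=
      integrableOn_Ioi_rpow_of_lt (by linarith) zero_lt_one
    refine h1.congr_fun (fun t ht => ?_) measurableSet_Ioi
    have ht1 : 1 < t := ht
    have ht0 : 0 < t := by linarith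
    simp only [smul_eq_mul]
    rw [min_eq_left ht1.le, ← Real.rpow_natCast, hcast, one_div, ← Real.rpow_neg ht0.le, one_mul,
      ← Real.rpow_add ht0]
    congr 1; ring

lemma kerTrunc_nonneg (ε : ℝ) (v : Euc N) : 0 ≤ kerTrunc s ε v :=
  Set.indicator_nonneg (fun _ _ => ker_nonneg _) _

lemma kerTrunc_neg (ε : ℝ) (v : Euc N) : kerTrunc s ε (-v) = kerTrunc s ε v := by
  simp [kerTrunc, Set.indicator, ker_neg]

lemma kerTrunc_le (ε : ℝ) (v : Euc N) : kerTrunc s ε v ≤ ker s v :=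
  Set.indicator_le_self' (fun _ _ => ker_nonneg _) _

lemma measurable_kerTrunc (ε : ℝ) : Measurable (kerTrunc s ε : Euc N → ℝ) :=
  measurable_ker.indicator (measurableSet_le measurable_const measurable_norm)

lemma integrable_kerTrunc (hN : 1 ≤ N) (hs0 : 0 < s) (hs1 : s < 1) {ε : ℝ} (hε : 0 < ε) :
    Integrable (kerTrunc s ε : Euc N → ℝ) := by
  refine ((integrable_min_ker hN hs0 hs1).const_mul (1 / min 1 ε)).mono'
    (measurable_kerTrunc ε).aestronglyMeasurable (ae_of_all _ fun v => ?_)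
  rw [Real.norm_of_nonneg (kerTrunc_nonneg _ _)]
  have hm : 0 < min 1 ε := lt_min one_pos hε
  unfold kerTrunc
  by_cases hv : ε ≤ ‖v‖
  · rw [Set.indicator_of_mem (by simpa using hv)]
    have : 1 ≤ 1 / min 1 ε * min 1 ‖v‖ := by
      rw [one_div, inv_mul_eq_div, one_le_div hm]
      exact min_le_min_left _ hv
    nlinarith [ker_nonneg (s := s) v]
  · rw [Set.indicator_of_notMem (by simpa using hv)]
    have := ker_nonneg (s := s) v
    positivity

lemma cs_pos (hs1 : s < 1) : 0 < cs N s := by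
  unfold cs
  have h1 : 0 < (volume (Metric.ball (0 : Euc (N - 1)) 1)).toReal :=
    ENNReal.toReal_pos (Metric.measure_ball_pos _ _ one_pos).ne' measure_ball_lt_top.ne
  have : 0 < 1 - s := by linarith
  positivity

end kernel

/-! ### Lipschitz test functions and nonlocal integration by parts -/

section test

variable {N : ℕ} {s : ℝ} {C ρ : ℝ} {ψ : Euc N → ℝ}

lemma IsTest.const_nonneg (hN : 1 ≤ N) (h : IsTest C ρ ψ) : 0 ≤ C := by
  have := euc_nontrivial hN
  obtain ⟨x, hx⟩ := exists_ne (0 : Euc N)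
  have h1 := (abs_nonneg _).trans (h.osc x 0)
  have : 0 < min 1 ‖x - 0‖ := by simp [hx]
  exact nonneg_of_mul_nonneg_left h1 this

lemma IsTest.continuous (hN : 1 ≤ N) (h : IsTest C ρ ψ) : Continuous ψ := by
  have hC := h.const_nonneg hN
  refine (LipschitzWith.of_dist_le_mul (K := ⟨C, hC⟩) fun x y => ?_).continuous
  rw [Real.dist_eq, dist_eq_norm]
  exact (h.osc x y).trans (mul_le_mul_of_nonneg_left (min_le_right _ _) hC)

/-- The oscillation bound is applied between `x` and a point outside the support. -/
lemma IsTest.abs_le (hN : 1 ≤ N) (h : IsTest C ρ ψ) (x : Euc N) : |ψ x| ≤ C := by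
  have := euc_nontrivial hN
  have hC := h.const_nonneg hN
  obtain ⟨y, hy⟩ := NormedSpace.exists_lt_norm ℝ (Euc N) ρ
  have h1 := h.osc x y
  rw [h.supp y hy, sub_zero] at h1
  exact h1.trans (mul_le_of_le_one_right hC (min_le_left _ _))

lemma IsTest.hasCompactSupport (h : IsTest C ρ ψ) : HasCompactSupport ψ :=
  HasCompactSupport.intro (isCompact_closedBall (0 : Euc N) ρ) fun x hx =>
    h.supp x (by simpa using hx)

lemma IsTest.integrable_mul (hN : 1 ≤ N) (h : IsTest C ρ ψ) {f : Euc N → ℝ} (hf : Continuous f) :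
    Integrable (fun x => f x * ψ x) :=
  (hf.mul (h.continuous hN)).integrable_of_hasCompactSupport h.hasCompactSupport.mul_left

lemma IsTest.integrable (hN : 1 ≤ N) (h : IsTest C ρ ψ) : Integrable ψ :=
  (h.continuous hN).integrable_of_hasCompactSupport h.hasCompactSupport

/-- The majorant of the difference quotients of test functions supported in `B̄_ρ`. -/
noncomputable def majorant (N : ℕ) (s ρ : ℝ) (p : Euc N × Euc N) : ℝ :=
  ((Metric.closedBall (0 : Euc N) ρ).indicator 1 p.1 +
    (Metric.closedBall (0 : Euc N) ρ).indicator 1 p.2) *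
    (min 1 ‖p.1 - p.2‖ * ker s (p.1 - p.2))

lemma integrable_prod_mul_sub {f K : Euc N → ℝ} (hf : Integrable f) (hK : Integrable K) :
    Integrable (fun p : Euc N × Euc N => f p.2 * K (p.1 - p.2)) := by
  have := hf.convolution_integrand (ContinuousLinearMap.mul ℝ ℝ) hK
  simpa [Measure.volume_eq_prod] using this

lemma integrable_prod_mul_sub' {f K : Euc N → ℝ} (hf : Integrable f) (hK : Integrable K)
    (hK' : ∀ v, K (-v) = K v) :
    Integrable (fun p : Euc N × Euc N => f p.1 * K (p.1 - p.2)) := by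
  have := (integrable_prod_mul_sub hf hK).swap
  refine this.congr (ae_of_all _ fun p => ?_)
  simp only [Function.comp, Prod.fst_swap, Prod.snd_swap]
  rw [← hK', neg_sub]

lemma integral_prod_mul_sub {f K : Euc N → ℝ} (hf : Integrable f) (hK : Integrable K) :
    ∫ p : Euc N × Euc N, f p.2 * K (p.1 - p.2) = (∫ x, f x) * ∫ v, K v := by
  rw [Measure.volume_eq_prod, integral_prod_symm _ (integrable_prod_mul_sub hf hK)]
  simp_rw [integral_const_mul, integral_sub_right_eq_self]
  rw [integral_mul_const]

lemma integral_prod_swap_eq (f : Euc N × Euc N → ℝ) :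
    ∫ p : Euc N × Euc N, f p.swap = ∫ p : Euc N × Euc N, f p := by
  rw [Measure.volume_eq_prod]
  exact integral_prod_swap f

lemma integrable_indicator_closedBall (ρ : ℝ) :
    Integrable ((Metric.closedBall (0 : Euc N) ρ).indicator (1 : Euc N → ℝ)) :=
  (integrable_indicator_iff measurableSet_closedBall).2
    (integrableOn_const (C := (1 : ℝ)) measure_closedBall_lt_top.ne)

lemma integrable_majorant (hN : 1 ≤ N) (hs0 : 0 < s) (hs1 : s < 1) (ρ : ℝ) :
    Integrable (majorant N s ρ) := by
  have hK := integrable_min_ker hN hs0 hs1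
  have h1 := integrable_prod_mul_sub' (integrable_indicator_closedBall ρ) hK
    (by intro v; simp [ker_neg])
  have h2 := integrable_prod_mul_sub (integrable_indicator_closedBall ρ) hK
  refine (h1.add h2).congr (ae_of_all _ fun p => ?_)
  simp only [majorant, Pi.add_apply]; ring

lemma integral_majorant (hN : 1 ≤ N) (hs0 : 0 < s) (hs1 : s < 1) (ρ : ℝ) :
    ∫ p, majorant N s ρ p = 2 * (volume (Metric.closedBall (0 : Euc N) ρ)).toReal *
      ∫ v : Euc N, min 1 ‖v‖ * ker s v := by
  have hK := integrable_min_ker hN hs0 hs1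
  have hev : ∀ v : Euc N, min 1 ‖-v‖ * ker s (-v) = min 1 ‖v‖ * ker s v := by
    intro v; simp [ker_neg]
  have hI := integrable_indicator_closedBall (N := N) ρ
  have h1 := integrable_prod_mul_sub' hI hK hev
  have h2 := integrable_prod_mul_sub hI hK
  have e1 : ∫ p : Euc N × Euc N, (Metric.closedBall (0 : Euc N) ρ).indicator (1 : Euc N → ℝ) p.1 *
      (min 1 ‖p.1 - p.2‖ * ker s (p.1 - p.2)) = ∫ p : Euc N × Euc N,
      (Metric.closedBall (0 : Euc N) ρ).indicator (1 : Euc N → ℝ) p.2 *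
      (min 1 ‖p.1 - p.2‖ * ker s (p.1 - p.2)) := by
    rw [← integral_prod_swap_eq (fun p : Euc N × Euc N =>
      (Metric.closedBall (0 : Euc N) ρ).indicator (1 : Euc N → ℝ) p.2 *
      (min 1 ‖p.1 - p.2‖ * ker s (p.1 - p.2)))]
    refine integral_congr_ae (ae_of_all _ fun p => ?_)
    simp only [Prod.fst_swap, Prod.snd_swap]
    rw [← hev, neg_sub]
  have e2 : ∫ x, (Metric.closedBall (0 : Euc N) ρ).indicator (1 : Euc N → ℝ) x
      = (volume (Metric.closedBall (0 : Euc N) ρ)).toReal := by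
    rw [integral_indicator_one measurableSet_closedBall]; rfl
  calc ∫ p, majorant N s ρ p
      = ∫ p : Euc N × Euc N, ((Metric.closedBall (0 : Euc N) ρ).indicator (1 : Euc N → ℝ) p.1 *
      (min 1 ‖p.1 - p.2‖ * ker s (p.1 - p.2)) +
      (Metric.closedBall (0 : Euc N) ρ).indicator (1 : Euc N → ℝ) p.2 *
      (min 1 ‖p.1 - p.2‖ * ker s (p.1 - p.2))) :=
        integral_congr_ae (ae_of_all _ fun p => by simp only [majorant]; ring)
    _ = _ := by
        rw [integral_add h1 h2, e1, integral_prod_mul_sub hI hK, e2]; ring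

lemma IsTest.abs_dq_le (hN : 1 ≤ N) (h : IsTest C ρ ψ) (p : Euc N × Euc N) :
    |dq s ψ p| ≤ C * majorant N s ρ p := by
  have hC := h.const_nonneg hN
  have hk := ker_nonneg (s := s) (p.1 - p.2)
  have hm : 0 ≤ min 1 ‖p.1 - p.2‖ := le_min zero_le_one (norm_nonneg _)
  rw [dq_eq, abs_mul, abs_of_nonneg hk, majorant]
  by_cases h1 : p.1 ∈ Metric.closedBall (0 : Euc N) ρ
  · have h2 : (0 : ℝ) ≤ (Metric.closedBall (0 : Euc N) ρ).indicator 1 p.2 :=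
      Set.indicator_nonneg (fun _ _ => zero_le_one) _
    rw [Set.indicator_of_mem h1, Pi.one_apply]
    calc _ ≤ C * min 1 ‖p.1 - p.2‖ * ker s (p.1 - p.2) :=
          mul_le_mul_of_nonneg_right (h.osc _ _) hk
      _ ≤ _ := by
          have : 0 ≤ C * ((min 1 ‖p.1 - p.2‖) * ker s (p.1 - p.2)) := by positivity
          nlinarith
  · by_cases h2 : p.2 ∈ Metric.closedBall (0 : Euc N) ρ
    · rw [Set.indicator_of_notMem h1, Set.indicator_of_mem h2, Pi.one_apply, zero_add, one_mul,
        ← mul_assoc]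
      exact mul_le_mul_of_nonneg_right (h.osc _ _) hk
    · rw [h.supp _ (by simpa using h1), h.supp _ (by simpa using h2),
        Set.indicator_of_notMem h1, Set.indicator_of_notMem h2]
      simp

lemma IsTest.continuous_diff (hN : 1 ≤ N) (h : IsTest C ρ ψ) :
    Continuous (fun p : Euc N × Euc N => ψ p.1 - ψ p.2) :=
  ((h.continuous hN).comp continuous_fst).sub ((h.continuous hN).comp continuous_snd)

lemma measurable_dq (hψ : Measurable ψ) : Measurable (dq s ψ) := by
  unfold dq; fun_prop

lemma IsTest.integrable_dq (hN : 1 ≤ N) (hs0 : 0 < s) (hs1 : s < 1) (h : IsTest C ρ ψ) :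
    Integrable (dq s ψ) :=
  ((integrable_majorant hN hs0 hs1 ρ).const_mul C).mono'
    (measurable_dq (h.continuous hN).measurable).aestronglyMeasurable
    (ae_of_all _ fun p => h.abs_dq_le hN p)

lemma IsTest.integrable_mul_dq (hN : 1 ≤ N) (hs0 : 0 < s) (hs1 : s < 1) (h : IsTest C ρ ψ)
    {z : Euc N × Euc N → ℝ} (hz : AEStronglyMeasurable z volume) (hz1 : ∀ᵐ p, |z p| ≤ 1) :
    Integrable (fun p => z p * dq s ψ p) :=
  (h.integrable_dq hN hs0 hs1).bdd_mul hz hz1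

/-- Nonlocal integration by parts for an integrable even kernel. -/
lemma integral_mul_integral_kernel {ψ K : Euc N → ℝ} {ζ : Euc N × Euc N → ℝ} (hψ : Integrable ψ)
    (hK : Integrable K) (hKe : ∀ v, K (-v) = K v) (hζ : AEStronglyMeasurable ζ volume)
    (hζ1 : ∀ p, |ζ p| ≤ 1) (hζa : ∀ x y, ζ (y, x) = - ζ (x, y)) :
    ∫ x, ψ x * ∫ y, ζ (x, y) * K (x - y) =
      1 / 2 * ∫ p : Euc N × Euc N, ζ p * ((ψ p.1 - ψ p.2) * K (p.1 - p.2)) := by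
  have h1 := (integrable_prod_mul_sub' hψ hK hKe).bdd_mul hζ (ae_of_all _ hζ1)
  have h2 := (integrable_prod_mul_sub hψ hK).bdd_mul hζ (ae_of_all _ hζ1)
  -- Exchanging the two variables changes the sign of `ζ` and leaves the even kernel unchanged.
  have e1 : ∫ p : Euc N × Euc N, ζ p * (ψ p.2 * K (p.1 - p.2)) = - ∫ p : Euc N × Euc N, ζ p * (ψ p.1 * K (p.1 - p.2)) := by
    rw [← integral_prod_swap_eq (fun p : Euc N × Euc N => ζ p * (ψ p.2 * K (p.1 - p.2))), ← integral_neg]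
    refine integral_congr_ae (ae_of_all _ fun p => ?_)
    simp only [Prod.fst_swap, Prod.snd_swap]
    rw [← hKe, neg_sub, show p.swap = (p.2, p.1) from rfl, hζa p.1 p.2]
    ring
  have e2 : ∫ p : Euc N × Euc N, ζ p * ((ψ p.1 - ψ p.2) * K (p.1 - p.2)) =
      2 * ∫ p : Euc N × Euc N, ζ p * (ψ p.1 * K (p.1 - p.2)) := by
    have : ∀ p : Euc N × Euc N, ζ p * ((ψ p.1 - ψ p.2) * K (p.1 - p.2)) =
      ζ p * (ψ p.1 * K (p.1 - p.2)) - ζ p * (ψ p.2 * K (p.1 - p.2)) := fun p => by ring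
    simp_rw [this]
    rw [integral_sub h1 h2, e1]; ring
  rw [e2]
  have e3 : ∫ p : Euc N × Euc N, ζ p * (ψ p.1 * K (p.1 - p.2)) =
      ∫ x, ψ x * ∫ y, ζ (x, y) * K (x - y) := by
    rw [Measure.volume_eq_prod] at h1 ⊢
    rw [integral_prod _ h1]
    refine integral_congr_ae (ae_of_all _ fun x => ?_)
    simp only
    rw [← integral_const_mul]
    congr 1; ext y; ring
  rw [e3]; ring

end test

/-! ### From smooth to Lipschitz test functions -/

section mollify

open scoped Convolution
open ContinuousLinearMap

variable {N : ℕ} {s : ℝ} {C ρ : ℝ} {ψ : Euc N → ℝ}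

/-- Averages of translates keep the oscillation constant, and the support grows by at most `1`. A
whole sequence of mollifications therefore has a common majorant. -/
lemma IsTest.mollify (hN : 1 ≤ N) (h : IsTest C ρ ψ) (φ : ContDiffBump (0 : Euc N))
    (hφ : φ.rOut ≤ 1) :
    IsTest C (ρ + 1) (φ.normed volume ⋆[lsmul ℝ ℝ, volume] ψ) := by
  have hc := h.continuous hN
  have hi : ∀ x, Integrable (fun t => φ.normed volume t * ψ (x - t)) := fun x =>
    (φ.continuous_normed.mul (hc.comp (continuous_const.sub continuous_id))).integrable_of_hasCompactSupport
      φ.hasCompactSupport_normed.mul_right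
  constructor
  · intro x y
    simp only [convolution_def, lsmul_apply, smul_eq_mul]
    rw [← integral_sub (hi x) (hi y), ← Real.norm_eq_abs]
    have h1 : Integrable (fun t => φ.normed volume t * (C * min 1 ‖x - y‖)) :=
      φ.integrable_normed.mul_const _
    refine (norm_integral_le_of_norm_le h1 (ae_of_all _ fun t => ?_)).trans ?_
    · rw [← mul_sub, norm_mul, Real.norm_of_nonneg (φ.nonneg_normed t)]
      refine mul_le_mul_of_nonneg_left ?_ (φ.nonneg_normed t)
      have := h.osc (x - t) (y - t)
      rwa [sub_sub_sub_cancel_right] at this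
    · rw [integral_mul_const, φ.integral_normed, one_mul]
  · intro x hx
    simp only [convolution_def, lsmul_apply, smul_eq_mul]
    refine integral_eq_zero_of_ae (ae_of_all _ fun t => ?_)
    by_cases ht : t ∈ Metric.ball (0 : Euc N) φ.rOut
    · have h1 : ‖t‖ < 1 := by
        have := mem_ball_zero_iff.1 ht
        linarith
      have h2 : ρ < ‖x - t‖ := by
        have := norm_sub_norm_le x t
        linarith
      simp [h.supp _ h2]
    · rw [← φ.support_normed_eq (μ := volume)] at ht
      simp [Function.notMem_support.1 ht]

/-- The weak formulation extends from smooth functions to Lipschitz functions with compact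
support. -/
lemma weak_of_smooth (hN : 1 ≤ N) (hs0 : 0 < s) (hs1 : s < 1) {h : ℝ} {g u : Euc N → ℝ}
    (hg : Continuous g) (hu : Continuous u) {z : Euc N × Euc N → ℝ}
    (hz : AEStronglyMeasurable z volume) (hz1 : ∀ᵐ p, |z p| ≤ 1)
    (hw : ∀ ψ : Euc N → ℝ, ContDiff ℝ (⊤ : ℕ∞) ψ → HasCompactSupport ψ →
      - h * divPairing s z ψ + ∫ x, u x * ψ x = ∫ x, g x * ψ x) (ht : IsTest C ρ ψ) :
    h * (cs N s / 2 * ∫ p, z p * dq s ψ p) + ∫ x, u x * ψ x = ∫ x, g x * ψ x := by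
  have hC := ht.const_nonneg hN
  let φ : ℕ → ContDiffBump (0 : Euc N) := fun n =>
    ⟨1 / (2 * ((n : ℝ) + 1)), 1 / ((n : ℝ) + 1), by positivity, by
      apply one_div_lt_one_div_of_lt <;> linarith [(Nat.cast_nonneg n : (0 : ℝ) ≤ n)]⟩
  have hφ1 : ∀ n, (φ n).rOut ≤ 1 := fun n => by
    change 1 / ((n : ℝ) + 1) ≤ 1
    rw [div_le_one (by positivity)]; linarith [(Nat.cast_nonneg n : (0 : ℝ) ≤ n)]
  have hφ0 : Tendsto (fun n => (φ n).rOut) atTop (𝓝 0) := tendsto_one_div_add_atTop_nhds_zero_nat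
  set ψn : ℕ → Euc N → ℝ := fun n => ((φ n).normed volume ⋆[lsmul ℝ ℝ, volume] ψ) with hψn
  have htn : ∀ n, IsTest C (ρ + 1) (ψn n) := fun n => ht.mollify hN (φ n) (hφ1 n)
  have hlim : ∀ x, Tendsto (fun n => ψn n x) atTop (𝓝 (ψ x)) := fun x =>
    ContDiffBump.convolution_tendsto_right_of_continuous hφ0 (ht.continuous hN) x
  have hsm : ∀ n, ContDiff ℝ (⊤ : ℕ∞) (ψn n) := fun n =>
    (φ n).hasCompactSupport_normed.contDiff_convolution_left _ (φ n).contDiff_normed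
      (ht.continuous hN).locallyIntegrable
  have heq : ∀ n, h * (cs N s / 2 * ∫ p, z p * dq s (ψn n) p) + ∫ x, u x * ψn n x
      = ∫ x, g x * ψn n x := by
    intro n
    have := hw (ψn n) (hsm n) (htn n).hasCompactSupport
    rw [← this]
    unfold divPairing dq
    ring
  have hL : ∀ f : Euc N → ℝ, Continuous f →
      Tendsto (fun n => ∫ x, f x * ψn n x) atTop (𝓝 (∫ x, f x * ψ x)) := by
    intro f hf
    refine tendsto_integral_of_dominated_convergence
      (fun x => (Metric.closedBall (0 : Euc N) (ρ + 1)).indicator (fun x => |f x| * C) x)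
      (fun n => ((htn n).integrable_mul hN hf).aestronglyMeasurable) ?_ (fun n => ae_of_all _ fun x => ?_)
      (ae_of_all _ fun x => (hlim x).const_mul _)
    · rw [integrable_indicator_iff measurableSet_closedBall]
      exact (hf.abs.mul continuous_const).continuousOn.integrableOn_compact (isCompact_closedBall _ _)
    · by_cases hx : x ∈ Metric.closedBall (0 : Euc N) (ρ + 1)
      · rw [Set.indicator_of_mem hx, norm_mul, Real.norm_eq_abs, Real.norm_eq_abs]
        exact mul_le_mul_of_nonneg_left ((htn n).abs_le hN x) (abs_nonneg _)
      · rw [Set.indicator_of_notMem hx, (htn n).supp x (by simpa using hx)]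
        simp
  have hD : Tendsto (fun n => ∫ p, z p * dq s (ψn n) p) atTop (𝓝 (∫ p, z p * dq s ψ p)) := by
    refine tendsto_integral_of_dominated_convergence (fun p => C * majorant N s (ρ + 1) p)
      (fun n => ((htn n).integrable_mul_dq hN hs0 hs1 hz hz1).aestronglyMeasurable)
      ((integrable_majorant hN hs0 hs1 _).const_mul C) (fun n => ?_)
      (ae_of_all _ fun p => ?_)
    · filter_upwards [hz1] with p hp
      rw [norm_mul, Real.norm_eq_abs, Real.norm_eq_abs]
      exact (mul_le_of_le_one_left (abs_nonneg _) hp).trans ((htn n).abs_dq_le hN p)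
    · refine Tendsto.const_mul _ ?_
      unfold dq
      exact ((hlim p.1).sub (hlim p.2)).div_const _
  have l1 := ((hD.const_mul (cs N s / 2)).const_mul h).add (hL u hu)
  have l2 := hL g hg
  simp_rw [heq] at l1
  exact tendsto_nhds_unique l1 l2

end mollify

/-! ### The saturated sign -/

/-- Truncation of a real number to `[-1, 1]`. -/
noncomputable def sat (t : ℝ) : ℝ := max (-1) (min t 1)

lemma continuous_sat : Continuous sat := by unfold sat; fun_prop

lemma abs_sat_le (t : ℝ) : |sat t| ≤ 1 := by
  unfold sat
  rw [abs_le]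
  exact ⟨le_max_left _ _, max_le (by norm_num) (min_le_right _ _)⟩

lemma sat_neg (t : ℝ) : sat (-t) = - sat t := by
  unfold sat
  rcases le_total t 1 with h1 | h1 <;> rcases le_total (-1) t with h2 | h2 <;>
  grind

lemma sat_sub_le {t t' d : ℝ} (hd : 0 ≤ d) (h : t - t' ≤ d) : sat t - sat t' ≤ d := by
  unfold sat
  grind

lemma sat_mono {t t' : ℝ} (h : t ≤ t') : sat t ≤ sat t' := by
  have := sat_sub_le le_rfl (sub_nonpos.2 h)
  linarith

/-- Approximate form of `z a = |a|`: outside the window `|a| < 1/ν` the saturation is the exact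
sign, and inside it `|a|` is at most `1/ν` while the product is nonnegative. -/
lemma sat_mul_self (ν a : ℝ) (hν : 0 < ν) : |a| - 1 / ν ≤ sat (ν * a) * a := by
  have h0 : 0 < 1 / ν := by positivity
  have hνi : ν * (1 / ν) = 1 := by field_simp
  unfold sat
  rcases le_total (ν * a) 1 with h1 | h1
  · rcases le_total (-1) (ν * a) with h2 | h2
    · rw [min_eq_left h1, max_eq_right h2]
      have h3 : a ≤ 1 / ν := by rw [le_div_iff₀ hν]; linarith
      have h4 : -(1 / ν) ≤ a := by
        rw [neg_le, le_div_iff₀ hν]; linarith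
      have : |a| ≤ 1 / ν := abs_le.2 ⟨h4, h3⟩
      nlinarith [mul_nonneg hν.le (mul_self_nonneg a)]
    · rw [min_eq_left h1, max_eq_left h2]
      have : a < 0 := by
        by_contra hc
        nlinarith [mul_nonneg hν.le (not_lt.1 hc)]
      rw [abs_of_neg this]; linarith
  · rw [min_eq_right h1, max_eq_right (by norm_num)]
    have : 0 < a := by
      by_contra hc
      nlinarith [mul_nonneg hν.le (neg_nonneg.2 (not_lt.1 hc))]
    rw [abs_of_pos this]; linarith

/-- Order preservation and compatibility with constants of `(a, b) ↦ ν a - sat (ν (a - b))`. -/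
lemma sat_monotone_shift {ν a b a' b' c : ℝ} (hν : 0 ≤ ν) (ha : a' ≤ a + c) (hb : b' ≤ b + c) :
    ν * a' - sat (ν * (a' - b')) ≤ ν * a - sat (ν * (a - b)) + ν * c := by
  have h1 : 0 ≤ ν * (a - a' + c) := mul_nonneg hν (by linarith)
  have h2 : 0 ≤ ν * (b - b' + c) := mul_nonneg hν (by linarith)
  have := sat_sub_le (t := ν * (a - b)) (t' := ν * (a' - b')) h1 (by nlinarith)
  nlinarith

/-! ### Monotone iteration for the regularized equation -/

section fixedPoint

variable {N : ℕ} {K : Euc N → ℝ} {ν : ℝ}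

/-- One step of the monotone iteration for the regularized equation. -/
noncomputable def satStep (K : Euc N → ℝ) (ν : ℝ) (u : Euc N → ℝ) (x : Euc N) : ℝ :=
  (‖x‖ + ∫ v, (ν * u x - sat (ν * (u x - u (x - v)))) * K v) / (1 + ν * ∫ v, K v)

lemma integrable_sat (hK : Integrable K) {u : Euc N → ℝ} (hu : Continuous u) (x : Euc N) :
    Integrable (fun v => sat (ν * (u x - u (x - v))) * K v) :=
  hK.bdd_mul (by have := continuous_sat; exact Continuous.aestronglyMeasurable (by fun_prop))
    (ae_of_all _ fun v => abs_sat_le _)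

lemma integrable_sat' (hK : Integrable K) {u : Euc N → ℝ} (hu : Continuous u) (x : Euc N) :
    Integrable (fun v => (ν * u x - sat (ν * (u x - u (x - v)))) * K v) := by
  simp_rw [sub_mul]
  exact (hK.const_mul _).sub (integrable_sat hK hu x)

lemma integral_sat' (hK : Integrable K) {u : Euc N → ℝ} (hu : Continuous u) (x : Euc N) :
    ∫ v, (ν * u x - sat (ν * (u x - u (x - v)))) * K v =
      ν * u x * (∫ v, K v) - ∫ v, sat (ν * (u x - u (x - v))) * K v := by
  simp_rw [sub_mul]
  rw [integral_sub (hK.const_mul _) (integrable_sat hK hu x), integral_const_mul]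

lemma continuous_of_le_add_norm {u : Euc N → ℝ} (hu : ∀ x y, u x ≤ u y + ‖x - y‖) :
    Continuous u := by
  refine (LipschitzWith.of_le_add (f := u) fun x y => ?_).continuous
  rw [dist_eq_norm]; exact hu x y

/-- Adding `ν u(x) ∫ K` to both sides of the equation makes its right-hand side monotone in `u`. The
same estimate serves twice: `c = 0` and `x = x'` give order preservation, and `c = ‖x - y‖`
propagates the Lipschitz constant through translations. -/
lemma satStep_le {u u' : Euc N → ℝ} {x x' : Euc N} {c : ℝ} (hν : 0 ≤ ν) (hK : Integrable K)
    (hK0 : ∀ v, 0 ≤ K v) (hu : Continuous u) (hu' : Continuous u') (hx : ‖x'‖ ≤ ‖x‖ + c)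
    (h : ∀ v, u' (x' - v) ≤ u (x - v) + c) :
    satStep K ν u' x' ≤ satStep K ν u x + c := by
  have hM : 0 ≤ ∫ v, K v := integral_nonneg hK0
  have hD : 0 < 1 + ν * ∫ v, K v := by positivity
  have h0 : u' x' ≤ u x + c := by simpa using h 0
  unfold satStep
  rw [div_add' _ _ _ hD.ne', div_le_div_iff_of_pos_right hD]
  have h1 : ∫ v, (ν * u' x' - sat (ν * (u' x' - u' (x' - v)))) * K v ≤
      ∫ v, ((ν * u x - sat (ν * (u x - u (x - v)))) * K v + ν * c * K v) := by
    refine integral_mono (integrable_sat' hK hu' x')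
      ((integrable_sat' hK hu x).add (hK.const_mul _)) fun v => ?_
    have := mul_le_mul_of_nonneg_right (sat_monotone_shift hν h0 (h v)) (hK0 v)
    simp only
    linarith
  rw [integral_add (integrable_sat' hK hu x) (hK.const_mul _), integral_const_mul] at h1
  nlinarith

/-- Convexity gives `2‖x‖ ≤ ‖x - v‖ + ‖x + v‖`. As `sat` is odd and increasing, the contributions of
`v` and `-v` add up to something nonpositive. Hence `‖x‖` is a subsolution and the iteration starts
by increasing. -/
lemma integral_sat_norm_nonpos (hK : Integrable K) (hK0 : ∀ v, 0 ≤ K v)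
    (hKe : ∀ v, K (-v) = K v) (hν : 0 ≤ ν) (x : Euc N) :
    ∫ v, sat (ν * (‖x‖ - ‖x - v‖)) * K v ≤ 0 := by
  have hi := integrable_sat (ν := ν) hK (u := fun x : Euc N => ‖x‖) continuous_norm x
  have e1 : ∫ v, sat (ν * (‖x‖ - ‖x - -v‖)) * K (-v) = ∫ v, sat (ν * (‖x‖ - ‖x - v‖)) * K v :=
    integral_neg_eq_self (fun v => sat (ν * (‖x‖ - ‖x - v‖)) * K v) volume
  have h2 : (∫ v, sat (ν * (‖x‖ - ‖x - v‖)) * K v) +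
      ∫ v, sat (ν * (‖x‖ - ‖x - -v‖)) * K (-v) ≤ 0 := by
    rw [← integral_add hi hi.comp_neg]
    refine integral_nonpos fun v => ?_
    simp only [hKe, Pi.zero_apply]
    rw [← add_mul]
    refine mul_nonpos_of_nonpos_of_nonneg ?_ (hK0 v)
    have h3 : ‖x‖ - ‖x - v‖ ≤ -(‖x‖ - ‖x - -v‖) := by
      have : ‖(2 : ℝ) • x‖ ≤ ‖x - v‖ + ‖x - -v‖ := by
        refine le_trans (le_of_eq ?_) (norm_add_le _ _)
        congr 1; rw [two_smul]; abel
      rw [norm_smul] at this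
      norm_num at this ⊢
      linarith
    have h4 := sat_mono (mul_le_mul_of_nonneg_left h3 hν)
    rw [mul_neg, sat_neg] at h4
    linarith
  rw [e1] at h2
  linarith

/-- Existence for the regularized equation with an integrable kernel. -/
lemma exists_regularized (hK : Integrable K) (hK0 : ∀ v, 0 ≤ K v)
    (hKe : ∀ v, K (-v) = K v) (hν : 0 ≤ ν) :
    ∃ u : Euc N → ℝ, (∀ x y, u x ≤ u y + ‖x - y‖) ∧ (∀ x, ‖x‖ ≤ u x) ∧
      ∀ x, u x + ∫ v, sat (ν * (u x - u (x - v))) * K v = ‖x‖ := by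
  set M := ∫ v, K v with hM
  have hM0 : 0 ≤ M := integral_nonneg hK0
  have hD : 0 < 1 + ν * M := by positivity
  let U : ℕ → Euc N → ℝ := fun k => (satStep K ν)^[k] (fun x => ‖x‖)
  have hU0 : U 0 = fun x => ‖x‖ := rfl
  have hUs : ∀ k, U (k + 1) = satStep K ν (U k) := fun k => Function.iterate_succ_apply' _ _ _
  have hlip : ∀ k x y, U k x ≤ U k y + ‖x - y‖ := by
    intro k
    induction k with
    | zero =>
      intro x y
      have := norm_sub_norm_le x y
      simp only [hU0]; linarith
    | succ k ih =>
      intro x y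
      have hc := continuous_of_le_add_norm ih
      rw [hUs]
      refine satStep_le hν hK hK0 hc hc ?_ fun v => ?_
      · have := norm_sub_norm_le x y; linarith
      · have := ih (x - v) (y - v)
        rwa [sub_sub_sub_cancel_right] at this
  have hc : ∀ k, Continuous (U k) := fun k => continuous_of_le_add_norm (hlip k)
  have hmono1 : ∀ k x, U k x ≤ U (k + 1) x := by
    intro k
    induction k with
    | zero =>
      intro x
      have h1 := integral_sat_norm_nonpos hK hK0 hKe hν x
      rw [hUs, satStep, le_div_iff₀ hD, integral_sat' hK (hc 0), ← hM]
      simp only [hU0]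
      nlinarith
    | succ k ih =>
      intro x
      have := satStep_le (c := 0) hν hK hK0 (hc (k + 1)) (hc k) (x := x) (x' := x) (by simp)
        (fun v => by simpa using ih (x - v))
      rw [hUs (k + 1)]
      nth_rewrite 1 [hUs k]
      simpa using this
  have hmono : ∀ x, Monotone fun k => U k x := fun x => monotone_nat_of_le_succ fun k => hmono1 k x
  -- This bound depends on the mass of the kernel and only ensures that the suprema are finite; the
  -- bound uniform in the regularization comes from hat functions.
  have hub : ∀ k x, U k x ≤ ‖x‖ + M := by
    intro k
    induction k with
    | zero => intro x; simp only [hU0]; linarith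
    | succ k ih =>
      intro x
      have h1 : - M ≤ ∫ v, sat (ν * (U k x - U k (x - v))) * K v := by
        rw [hM, ← integral_neg]
        refine integral_mono hK.neg (integrable_sat hK (hc k) x) fun v => ?_
        have := (abs_le.1 (abs_sat_le (ν * (U k x - U k (x - v))))).1
        have := mul_le_mul_of_nonneg_right this (hK0 v)
        linarith
      rw [hUs, satStep, div_le_iff₀ hD, integral_sat' hK (hc k), ← hM]
      have := mul_le_mul_of_nonneg_right (mul_le_mul_of_nonneg_left (ih x) hν) hM0
      nlinarith
  let u : Euc N → ℝ := fun x => ⨆ k, U k x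
  have hlim : ∀ x, Tendsto (fun k => U k x) atTop (𝓝 (u x)) := fun x =>
    tendsto_atTop_ciSup (hmono x) ⟨‖x‖ + M, by rintro _ ⟨k, rfl⟩; exact hub k x⟩
  have hulip : ∀ x y, u x ≤ u y + ‖x - y‖ := fun x y =>
    le_of_tendsto_of_tendsto' (hlim x) ((hlim y).add_const _) fun k => hlip k x y
  refine ⟨u, hulip, fun x => ge_of_tendsto' (hlim x) fun k => hmono x (Nat.zero_le k), fun x => ?_⟩
  have hI : Tendsto (fun k => ∫ v, sat (ν * (U k x - U k (x - v))) * K v) atTop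
      (𝓝 (∫ v, sat (ν * (u x - u (x - v))) * K v)) := by
    refine tendsto_integral_of_dominated_convergence K
      (fun k => (integrable_sat hK (hc k) x).aestronglyMeasurable) hK
      (fun k => ae_of_all _ fun v => ?_) (ae_of_all _ fun v => ?_)
    · rw [norm_mul, Real.norm_eq_abs, Real.norm_of_nonneg (hK0 v)]
      exact mul_le_of_le_one_left (hK0 v) (abs_sat_le _)
    · exact ((continuous_sat.tendsto _).comp
        (((hlim x).sub (hlim (x - v))).const_mul ν)).mul_const _
  have h1 : Tendsto (fun k => U (k + 1) x) atTop (𝓝 (u x)) :=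
    (tendsto_add_atTop_iff_nat 1).2 (hlim x)
  have h2 : Tendsto (fun k => U (k + 1) x) atTop (𝓝 ((‖x‖ + (ν * u x * M -
      ∫ v, sat (ν * (u x - u (x - v))) * K v)) / (1 + ν * M))) := by
    simp_rw [hUs, satStep]
    have := (((((hlim x).const_mul ν).mul_const M).sub hI).const_add ‖x‖).div_const (1 + ν * M)
    refine this.congr fun k => ?_
    rw [integral_sat' hK (hc k)]
  have h3 := tendsto_nhds_unique h1 h2
  rw [eq_div_iff hD.ne'] at h3
  linarith

end fixedPoint

/-! ### The perimeter as a double integral of jumps -/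

section perimeter

variable {N : ℕ} {s : ℝ}

/-- The weighted difference quotients of the indicator function of `F`, in absolute value. -/
noncomputable def jump (s : ℝ) (F : Set (Euc N)) (p : Euc N × Euc N) : ℝ :=
  |F.indicator (1 : Euc N → ℝ) p.1 - F.indicator (1 : Euc N → ℝ) p.2| * ker s (p.1 - p.2)

lemma measurable_jump {F : Set (Euc N)} (hF : MeasurableSet F) : Measurable (jump s F) := by
  have h1 : Measurable (F.indicator (1 : Euc N → ℝ)) := measurable_one.indicator hF
  have h2 := measurable_ker (N := N) (s := s)
  unfold jump
  exact ((h1.comp measurable_fst).sub (h1.comp measurable_snd)).abs.mul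
    (h2.comp (measurable_fst.sub measurable_snd))

lemma jump_nonneg (F : Set (Euc N)) (p : Euc N × Euc N) : 0 ≤ jump s F p :=
  mul_nonneg (abs_nonneg _) (ker_nonneg _)

/-- The jump lives on `F × Fᶜ` and `Fᶜ × F`, which contribute equally by symmetry of the kernel. -/
lemma lintegral_jump {F : Set (Euc N)} (hF : MeasurableSet F) :
    ∫⁻ p : Euc N × Euc N, ENNReal.ofReal (jump s F p) =
      2 * ∫⁻ x in F, ∫⁻ y in Fᶜ, ENNReal.ofReal (1 / ‖x - y‖ ^ ((N : ℝ) + s)) := by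
  have hk : Measurable fun p : Euc N × Euc N => ENNReal.ofReal (ker s (p.1 - p.2)) :=
    (measurable_ker.comp (measurable_fst.sub measurable_snd)).ennreal_ofReal
  have hA : ∫⁻ p in F ×ˢ Fᶜ, ENNReal.ofReal (ker s (p.1 - p.2)) =
      ∫⁻ x in F, ∫⁻ y in Fᶜ, ENNReal.ofReal (1 / ‖x - y‖ ^ ((N : ℝ) + s)) := by
    rw [Measure.volume_eq_prod, setLIntegral_prod _ hk.aemeasurable]
    rfl
  have hB : ∫⁻ p in Fᶜ ×ˢ F, ENNReal.ofReal (ker s (p.1 - p.2)) =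
      ∫⁻ p in F ×ˢ Fᶜ, ENNReal.ofReal (ker s (p.1 - p.2)) := by
    rw [Measure.volume_eq_prod, setLIntegral_prod_symm _ hk.aemeasurable,
      setLIntegral_prod _ hk.aemeasurable]
    refine lintegral_congr fun x => lintegral_congr fun y => ?_
    simp only
    rw [← ker_neg, neg_sub]
  have hdisj : Disjoint (F ×ˢ Fᶜ) (Fᶜ ×ˢ F) := by
    rw [Set.disjoint_left]
    rintro ⟨x, y⟩ ⟨h1, _⟩ ⟨h2, _⟩
    exact h2 h1
  calc ∫⁻ p : Euc N × Euc N, ENNReal.ofReal (jump s F p)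
      = ∫⁻ p in (F ×ˢ Fᶜ) ∪ (Fᶜ ×ˢ F), ENNReal.ofReal (ker s (p.1 - p.2)) := by
        rw [← lintegral_indicator ((hF.prod hF.compl).union (hF.compl.prod hF))]
        refine lintegral_congr fun p => ?_
        by_cases h1 : p.1 ∈ F <;> by_cases h2 : p.2 ∈ F <;>
          simp [jump, Set.indicator, h1, h2]
    _ = _ := by
        rw [lintegral_union (hF.compl.prod hF) hdisj, hB, hA, two_mul]

lemma perimeter_eq (hs1 : s < 1) {F : Set (Euc N)} (hF : MeasurableSet F) :
    perimeter s F = ENNReal.ofReal (cs N s / 2) *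
      ∫⁻ p : Euc N × Euc N, ENNReal.ofReal (jump s F p) := by
  have := cs_pos (N := N) hs1
  rw [lintegral_jump hF, perimeter, ← mul_assoc]
  congr 1
  rw [ENNReal.ofReal_div_of_pos two_pos, ENNReal.ofReal_ofNat]
  exact (ENNReal.div_mul_cancel (by simp) (by simp)).symm

lemma integrable_jump (hs1 : s < 1) {F : Set (Euc N)} (hF : MeasurableSet F)
    (hP : perimeter s F ≠ ⊤) : Integrable (jump s F) := by
  refine ⟨(measurable_jump hF).aestronglyMeasurable, ?_⟩
  rw [hasFiniteIntegral_iff_ofReal (ae_of_all _ (jump_nonneg F)), lt_top_iff_ne_top]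
  intro h
  rw [perimeter_eq hs1 hF, h, ENNReal.mul_top] at hP
  · exact hP rfl
  · have := cs_pos (N := N) hs1
    simpa using this

lemma toReal_perimeter (hs1 : s < 1) {F : Set (Euc N)} (hF : MeasurableSet F) :
    (perimeter s F).toReal = cs N s / 2 * ∫ p, jump s F p := by
  have := cs_pos (N := N) hs1
  rw [perimeter_eq hs1 hF, ENNReal.toReal_mul, ENNReal.toReal_ofReal (by positivity),
    integral_eq_lintegral_of_nonneg_ae (ae_of_all _ (jump_nonneg F))
      (measurable_jump hF).aestronglyMeasurable]

end perimeter

/-! ### Testing with hat functions near the origin -/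

section hat

variable {N : ℕ} {s : ℝ}

/-- The hat function of radius `r`. -/
noncomputable def hat (r : ℝ) (x : Euc N) : ℝ := max 0 (1 - ‖x‖ / r)

lemma isTest_hat {r : ℝ} (hr : 0 < r) (hr1 : r ≤ 1) : IsTest (1 / r) r (hat r : Euc N → ℝ) := by
  constructor
  · intro x y
    have h1 : |hat r x - hat r y| ≤ ‖x - y‖ / r := by
      have key : |‖x‖ / r - ‖y‖ / r| ≤ ‖x - y‖ / r := by
        rw [← sub_div, abs_div, abs_of_pos hr]
        exact div_le_div_of_nonneg_right (abs_norm_sub_norm_le _ _) hr.le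
      unfold hat
      rw [abs_le] at key ⊢
      have := norm_nonneg (x - y)
      have : 0 ≤ ‖x - y‖ / r := by positivity
      generalize ‖x‖ / r = a, ‖y‖ / r = b, ‖x - y‖ / r = d at *
      grind
    have h2 : |hat r x - hat r y| ≤ 1 := by
      have hx : ∀ x : Euc N, 0 ≤ hat r x ∧ hat r x ≤ 1 := fun x =>
        ⟨le_max_left _ _, max_le zero_le_one (by
          have : 0 ≤ ‖x‖ / r := by positivity
          linarith)⟩
      rw [abs_le]
      have := hx x; have := hx y
      constructor <;> linarith
    rcases le_total 1 ‖x - y‖ with h | h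
    · rw [min_eq_left h, mul_one]
      exact h2.trans (by rw [le_div_iff₀ hr]; linarith)
    · rw [min_eq_right h, one_div, inv_mul_eq_div]; exact h1
  · intro x hx
    unfold hat
    refine max_eq_left ?_
    have : 1 ≤ ‖x‖ / r := by rw [le_div_iff₀ hr]; linarith
    linarith

/-- A bound at the origin for `1`-Lipschitz solutions. -/
lemma apply_zero_le_of_weak (hN : 1 ≤ N) (hs0 : 0 < s) (hs1 : s < 1) :
    ∃ A : ℝ, 0 ≤ A ∧ ∀ h r : ℝ, 0 < h → 0 < r → r ≤ 1 → ∀ (u : Euc N → ℝ)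
      (z : Euc N × Euc N → ℝ), (∀ x y, u x ≤ u y + ‖x - y‖) → AEStronglyMeasurable z volume →
      (∀ᵐ p, |z p| ≤ 1) →
      (h * (cs N s / 2 * ∫ p, z p * dq s (hat r) p) + ∫ x, u x * hat r x = ∫ x : Euc N, ‖x‖ * hat r x) →
      u 0 ≤ 2 * r + A * h / r := by
  set m := ∫ v : Euc N, min 1 ‖v‖ * ker s v with hm
  have hm0 : 0 ≤ m := integral_nonneg fun v =>
    mul_nonneg (le_min zero_le_one (norm_nonneg _)) (ker_nonneg _)
  have hc := cs_pos (N := N) hs1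
  -- The field term is at most `h c_s m |B_r| / r`, and `∫ hat ≥ |B_r| / 2^(N+1)` because the hat is
  -- at least `1/2` on `B_{r/2}`; the constant is the resulting quotient.
  refine ⟨cs N s * m * 2 ^ (N + 1), by positivity, ?_⟩
  intro h r hh hr hr1 u z hu hz hz1 hw
  have ht := isTest_hat (N := N) hr hr1
  have hucont := continuous_of_le_add_norm hu
  have hhat0 : ∀ x : Euc N, 0 ≤ hat r x := fun x => le_max_left _ _
  set V := (volume (Metric.closedBall (0 : Euc N) 1)).toReal with hV
  have hV0 : 0 < V := ENNReal.toReal_pos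
    (Metric.measure_closedBall_pos _ _ one_pos).ne' measure_closedBall_lt_top.ne
  have hball : ∀ t : ℝ, 0 ≤ t → (volume (Metric.closedBall (0 : Euc N) t)).toReal = t ^ N * V := by
    intro t h0
    rw [Measure.addHaar_closedBall' _ _ h0, ENNReal.toReal_mul, ENNReal.toReal_ofReal (by positivity)]
    simp [hV]
  set I := ∫ x : Euc N, hat r x with hI
  have hIlow : (r / 2) ^ N * V / 2 ≤ I := by
    have h1 : ∫ x in Metric.closedBall (0 : Euc N) (r / 2), (1 / 2 : ℝ) ≤
        ∫ x in Metric.closedBall (0 : Euc N) (r / 2), hat r x := by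
      refine setIntegral_mono_on (integrableOn_const measure_closedBall_lt_top.ne)
        (ht.integrable hN).integrableOn measurableSet_closedBall fun x hx => ?_
      refine le_trans ?_ (le_max_right _ _)
      have : ‖x‖ / r ≤ 1 / 2 := by
        rw [div_le_iff₀ hr]
        have := mem_closedBall_zero_iff.1 hx
        linarith
      linarith
    have h2 := setIntegral_le_integral (s := Metric.closedBall (0 : Euc N) (r / 2))
      (ht.integrable hN) (ae_of_all _ hhat0)
    rw [setIntegral_const, smul_eq_mul, Measure.real, hball _ (by positivity)] at h1
    linarith
  have hdq : |∫ p, z p * dq s (hat r) p| ≤ 1 / r * (2 * (r ^ N * V) * m) := by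
    rw [← hball r hr.le, hm, ← integral_majorant hN hs0 hs1, ← integral_const_mul,
      ← Real.norm_eq_abs]
    refine norm_integral_le_of_norm_le ((integrable_majorant hN hs0 hs1 _).const_mul _) ?_
    filter_upwards [hz1] with p hp
    rw [norm_mul, Real.norm_eq_abs, Real.norm_eq_abs]
    exact (mul_le_of_le_one_left (abs_nonneg _) hp).trans (ht.abs_dq_le hN p)
  have hnorm : ∫ x : Euc N, ‖x‖ * hat r x ≤ r * I := by
    rw [hI, ← integral_const_mul]
    refine integral_mono (ht.integrable_mul hN continuous_norm) ((ht.integrable hN).const_mul _)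
      fun x => ?_
    simp only
    by_cases hx : r < ‖x‖
    · simp [ht.supp x hx]
    · exact mul_le_mul_of_nonneg_right (not_lt.1 hx) (hhat0 x)
  have hulow : (u 0 - r) * I ≤ ∫ x, u x * hat r x := by
    rw [hI, ← integral_const_mul]
    refine integral_mono ((ht.integrable hN).const_mul _) (ht.integrable_mul hN hucont)
      fun x => ?_
    simp only
    by_cases hx : r < ‖x‖
    · simp [ht.supp x hx]
    · refine mul_le_mul_of_nonneg_right ?_ (hhat0 x)
      have := hu 0 x
      simp only [zero_sub, norm_neg] at this
      linarith
  have hmain : (u 0 - 2 * r) * I ≤ h * cs N s * m * (r ^ N * V) / r := by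
    have h1 := mul_le_mul_of_nonneg_left (abs_le.1 hdq).1 (by positivity : 0 ≤ h * (cs N s / 2))
    have h2 : h * (cs N s / 2) * (1 / r * (2 * (r ^ N * V) * m)) =
      h * cs N s * m * (r ^ N * V) / r := by ring
    nlinarith
  by_cases hneg : u 0 - 2 * r ≤ 0
  · have : 0 ≤ cs N s * m * 2 ^ (N + 1) * h / r := by positivity
    linarith
  · have h3 := (mul_le_mul_of_nonneg_left hIlow (not_le.1 hneg).le).trans hmain
    have hrN : 0 < r ^ N * V := by positivity
    have h4 : (u 0 - 2 * r) * ((r / 2) ^ N * V / 2) = (u 0 - 2 * r) / 2 ^ (N + 1) * (r ^ N * V) := by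
      rw [div_pow, pow_succ]; field_simp
    have h5 : h * cs N s * m * (r ^ N * V) / r = h * cs N s * m / r * (r ^ N * V) := by ring
    rw [h4, h5] at h3
    have h6 := le_of_mul_le_mul_right h3 hrN
    rw [div_le_iff₀ (by positivity)] at h6
    have h7 : cs N s * m * 2 ^ (N + 1) * h / r = h * cs N s * m / r * 2 ^ (N + 1) := by ring
    linarith

end hat

/-! ### Approximate solutions and pointwise compactness -/

section approx

variable {N : ℕ} {s h : ℝ}

/-- Solutions of the regularized problem at level `n`, with datum `|x|`. -/
structure ApproxSol (s h : ℝ) (n : ℕ) (u : Euc N → ℝ) (z : Euc N × Euc N → ℝ) : Prop where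
  lip : ∀ x y, u x ≤ u y + ‖x - y‖
  ge : ∀ x, ‖x‖ ≤ u x
  meas : Measurable z
  bdd : ∀ p, |z p| ≤ 1
  align : ∀ p, |u p.1 - u p.2| - 1 / ((n : ℝ) + 1) ≤ z p * (u p.1 - u p.2)
  weak : ∀ (C ρ : ℝ) (ψ : Euc N → ℝ), IsTest C ρ ψ →
    h * (cs N s / 2 * ∫ p, z p * dq s ψ p) + ∫ x, u x * ψ x = ∫ x, ‖x‖ * ψ x
  calib : ∀ F : Set (Euc N), MeasurableSet F → volume F ≠ ⊤ → perimeter s F ≠ ⊤ →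
    ∫ x in F, (u x - ‖x‖) ≤ h * (perimeter s F).toReal

/-- The number `ν = n + 1` is at once the slope of the saturation and the inverse of the cut-off
radius. The field is the saturated difference, set to zero where `|x - y| < 1/ν`. -/
lemma exists_approxSol (hN : 1 ≤ N) (hs0 : 0 < s) (hs1 : s < 1) (hh : 0 < h) (n : ℕ) :
    ∃ (u : Euc N → ℝ) (z : Euc N × Euc N → ℝ), ApproxSol s h n u z := by
  have hc := cs_pos (N := N) hs1
  set ν : ℝ := (n : ℝ) + 1 with hν
  have hν0 : 0 < ν := by positivity
  have hε : 0 < 1 / ν := by positivity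
  set K : Euc N → ℝ := fun v => h * cs N s * kerTrunc s (1 / ν) v with hKdef
  have hK : Integrable K := (integrable_kerTrunc hN hs0 hs1 hε).const_mul _
  have hK0 : ∀ v, 0 ≤ K v := fun v => mul_nonneg (by positivity) (kerTrunc_nonneg _ _)
  have hKe : ∀ v, K (-v) = K v := fun v => by simp only [hKdef, kerTrunc_neg]
  obtain ⟨u, hlip, hge, hu⟩ := exists_regularized hK hK0 hKe hν0.le
  have huc := continuous_of_le_add_norm hlip
  set ζ : Euc N × Euc N → ℝ := fun p => sat (ν * (u p.1 - u p.2)) with hζdef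
  have hζc : Continuous ζ := by
    have := continuous_sat
    fun_prop
  have hζ1 : ∀ p, |ζ p| ≤ 1 := fun p => abs_sat_le _
  have hζa : ∀ x y, ζ (y, x) = - ζ (x, y) := fun x y => by
    simp only [hζdef]; rw [← sat_neg]; ring_nf
  have hpt : ∀ x, u x - ‖x‖ = - ∫ y, ζ (x, y) * K (x - y) := by
    intro x
    have e := integral_sub_left_eq_self (fun y => ζ (x, y) * K (x - y)) volume x
    simp only [sub_sub_cancel] at e
    have := hu x
    rw [← e]
    simp only [hζdef]
    linarith
  set S : Set (Euc N × Euc N) := {p | 1 / ν ≤ ‖p.1 - p.2‖} with hS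
  have hSm : MeasurableSet S := measurableSet_le measurable_const (by fun_prop)
  -- The cut-off is moved from the kernel to the field, so that the weak equation carries the full
  -- kernel.
  have hKS : ∀ (p : Euc N × Euc N) (a : ℝ), ζ p * (a * K (p.1 - p.2)) =
      h * cs N s * (S.indicator ζ p * (a * ker s (p.1 - p.2))) := by
    intro p a
    simp only [hKdef, kerTrunc]
    by_cases hp : 1 / ν ≤ ‖p.1 - p.2‖
    · rw [Set.indicator_of_mem (by exact hp), Set.indicator_of_mem (by exact hp)]; ring
    · rw [Set.indicator_of_notMem (by exact hp), Set.indicator_of_notMem (by exact hp)]; ring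
  have hzb : ∀ p, |S.indicator ζ p| ≤ 1 := by
    intro p
    by_cases hp : p ∈ S
    · rw [Set.indicator_of_mem hp]; exact hζ1 p
    · rw [Set.indicator_of_notMem hp]; simp
  refine ⟨u, S.indicator ζ, hlip, hge, hζc.measurable.indicator hSm, hzb, ?_, ?_, ?_⟩
  · intro p
    by_cases hp : p ∈ S
    · rw [Set.indicator_of_mem hp]
      exact sat_mul_self ν _ hν0
    -- Near the diagonal the field vanishes, but there the Lipschitz bound makes the difference
    -- itself smaller than `1/ν`.
    · rw [Set.indicator_of_notMem hp, zero_mul]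
      have h1 := hlip p.1 p.2
      have h2 := hlip p.2 p.1
      rw [norm_sub_rev] at h2
      have h3 : ‖p.1 - p.2‖ < 1 / ν := not_le.1 hp
      have : |u p.1 - u p.2| ≤ 1 / ν := abs_le.2 ⟨by linarith, by linarith⟩
      linarith
  · intro C ρ ψ hψ
    have e := integral_mul_integral_kernel (hψ.integrable hN) hK hKe
      hζc.aestronglyMeasurable hζ1 hζa
    simp_rw [hKS] at e
    rw [integral_const_mul] at e
    have e2 : ∫ x, ψ x * ∫ y, ζ (x, y) * K (x - y) = ∫ x, (‖x‖ * ψ x - u x * ψ x) := by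
      refine integral_congr_ae (ae_of_all _ fun x => ?_)
      simp only
      have := hpt x
      rw [show (∫ y, ζ (x, y) * K (x - y)) = ‖x‖ - u x by linarith]; ring
    rw [e2, integral_sub (hψ.integrable_mul hN continuous_norm) (hψ.integrable_mul hN huc)] at e
    simp_rw [dq_eq]
    linarith
  · intro F hF hFv hP
    have hi : Integrable (F.indicator (1 : Euc N → ℝ)) :=
      (integrable_indicator_iff hF).2 (integrableOn_const (C := (1 : ℝ)) hFv)
    -- The truncated kernel is integrable, so the indicator of `F`, which is not Lipschitz, may be
    -- used as a test function before the limit; `|z| ≤ 1` then yields the perimeter.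
    have e := integral_mul_integral_kernel hi hK hKe
      hζc.aestronglyMeasurable hζ1 hζa
    simp_rw [hKS] at e
    rw [integral_const_mul] at e
    have e2 : ∫ x, F.indicator (1 : Euc N → ℝ) x * ∫ y, ζ (x, y) * K (x - y) =
        - ∫ x in F, (u x - ‖x‖) := by
      rw [← integral_indicator hF, ← integral_neg]
      refine integral_congr_ae (ae_of_all _ fun x => ?_)
      simp only
      by_cases hx : x ∈ F
      · rw [Set.indicator_of_mem hx, Set.indicator_of_mem hx, hpt x]; simp
      · rw [Set.indicator_of_notMem hx, Set.indicator_of_notMem hx]; simp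
    rw [e2] at e
    have hj := integrable_jump hs1 hF hP
    have hlow : - ∫ p, jump s F p ≤ ∫ p : Euc N × Euc N, S.indicator ζ p *
        ((F.indicator (1 : Euc N → ℝ) p.1 - F.indicator (1 : Euc N → ℝ) p.2) *
          ker s (p.1 - p.2)) := by
      refine (abs_le.1 ?_).1
      rw [← Real.norm_eq_abs]
      refine norm_integral_le_of_norm_le hj (ae_of_all _ fun p => ?_)
      rw [norm_mul, norm_mul, Real.norm_eq_abs, Real.norm_eq_abs,
        Real.norm_of_nonneg (ker_nonneg _), jump]
      exact mul_le_of_le_one_left (mul_nonneg (abs_nonneg _) (ker_nonneg _)) (hzb p)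
    rw [toReal_perimeter hs1 hF]
    have := mul_le_mul_of_nonneg_left hlow (by positivity : 0 ≤ h * cs N s)
    nlinarith

/-- A uniform bound for the approximate solutions. -/
lemma ApproxSol.le_add (hN : 1 ≤ N) (hs0 : 0 < s) (hs1 : s < 1) (hh : 0 < h) :
    ∃ B : ℝ, ∀ (n : ℕ) (u : Euc N → ℝ) (z : Euc N × Euc N → ℝ), ApproxSol s h n u z →
      ∀ x, u x ≤ ‖x‖ + B := by
  obtain ⟨A, -, hA⟩ := apply_zero_le_of_weak (N := N) hN hs0 hs1
  refine ⟨2 * 1 + A * h / 1, fun n u z hu x => ?_⟩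
  have := hA h 1 hh one_pos le_rfl u z hu.lip hu.meas.aestronglyMeasurable (ae_of_all _ hu.bdd)
    (hu.weak _ _ _ (isTest_hat one_pos le_rfl))
  have h1 := hu.lip x 0
  rw [sub_zero] at h1
  linarith

/-- Pointwise subsequential limits of `1`-Lipschitz functions. -/
lemma exists_subseq_pointwise {E : Type*} [PseudoMetricSpace E] [TopologicalSpace.SeparableSpace E]
    [Nonempty E] (f : ℕ → E → ℝ) (hf : ∀ n x y, f n x ≤ f n y + dist x y) (a b : E → ℝ)
    (hab : ∀ n x, f n x ∈ Set.Icc (a x) (b x)) :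
    ∃ (u : E → ℝ) (k : ℕ → ℕ), StrictMono k ∧
      ∀ x, Tendsto (fun n => f (k n) x) atTop (𝓝 (u x)) := by
  let d := TopologicalSpace.denseSeq E
  -- Diagonal extraction along a dense sequence, as compactness of a countable product of intervals;
  -- the Lipschitz bound extends convergence to all points.
  have hcpt : IsCompact (Set.pi Set.univ fun i : ℕ => Set.Icc (a (d i)) (b (d i))) :=
    isCompact_univ_pi fun i => isCompact_Icc
  obtain ⟨l, -, k, hk, hl⟩ := hcpt.tendsto_subseq (x := fun n i => f n (d i))
    (fun n i _ => hab n (d i))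
  rw [tendsto_pi_nhds] at hl
  have hcau : ∀ x, ∃ y, Tendsto (fun n => f (k n) x) atTop (𝓝 y) := by
    intro x
    refine cauchySeq_tendsto_of_complete ?_
    rw [Metric.cauchySeq_iff']
    intro ε hε
    obtain ⟨i, hi⟩ : ∃ i, dist x (d i) < ε / 3 := by
      have := (TopologicalSpace.denseRange_denseSeq E).exists_dist_lt x (by positivity : 0 < ε / 3)
      simpa using this
    obtain ⟨M, hM⟩ := Metric.cauchySeq_iff'.1 (hl i).cauchySeq (ε / 3) (by positivity)
    refine ⟨M, fun n hn => ?_⟩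
    have h1 := hM n hn
    rw [Real.dist_eq, abs_lt] at h1 ⊢
    simp only [Function.comp] at h1
    have h2 := hf (k n) x (d i)
    have h3 := hf (k n) (d i) x
    have h4 := hf (k M) x (d i)
    have h5 := hf (k M) (d i) x
    rw [dist_comm] at h3 h5
    constructor <;> linarith
  choose u hu using hcau
  exact ⟨u, k, hk, hu⟩

end approx

/-! ### Weak compactness of bounded fields -/

/-- Weak sequential compactness of the unit ball of `L^∞`, tested against bounded functions. -/
lemma exists_subseq_weak {α : Type*} [MeasurableSpace α] [MeasurableSpace.CountablyGenerated α]
    (μ : Measure α) [IsFiniteMeasure μ] (z : ℕ → α → ℝ) (hz : ∀ n, Measurable (z n))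
    (hz1 : ∀ n p, |z n p| ≤ 1) :
    ∃ (w : α → ℝ) (k : ℕ → ℕ), StrictMono k ∧ Measurable w ∧ (∀ᵐ p ∂μ, |w p| ≤ 1) ∧
      ∀ (f : α → ℝ) (C : ℝ), Measurable f → (∀ p, |f p| ≤ C) →
        Tendsto (fun n => ∫ p, z (k n) p * f p ∂μ) atTop (𝓝 (∫ p, w p * f p ∂μ)) := by
  have hmem : ∀ n, MemLp (z n) 2 μ := fun n =>
    MemLp.of_bound (hz n).aestronglyMeasurable 1 (ae_of_all _ fun p => hz1 n p)
  let Z : ℕ → Lp ℝ 2 μ := fun n => (hmem n).toLp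
  set D : ℝ := measureUnivNNReal μ ^ (2 : ENNReal).toReal⁻¹ * 1 with hD
  have hZ : ∀ n, ‖Z n‖ ≤ D := fun n => Lp.norm_le_of_ae_bound zero_le_one (by
    filter_upwards [(hmem n).coeFn_toLp] with p hp
    rw [hp]; exact hz1 n p)
  -- On a finite measure space the fields are bounded in `L²`, which is separable because the
  -- σ-algebra is countably generated, so Banach–Alaoglu gives a weakly convergent subsequence.
  let Λ : ℕ → WeakDual ℝ (Lp ℝ 2 μ) := fun n =>
    StrongDual.toWeakDual (InnerProductSpace.toDual ℝ (Lp ℝ 2 μ) (Z n))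
  have hΛ : ∀ n, Λ n ∈ WeakDual.toStrongDual ⁻¹'
      Metric.closedBall (0 : StrongDual ℝ (Lp ℝ 2 μ)) D := by
    intro n
    rw [Set.mem_preimage, mem_closedBall_zero_iff]
    exact ((InnerProductSpace.toDual ℝ (Lp ℝ 2 μ)).norm_map (Z n)).trans_le (hZ n)
  have hp : Fact ((2 : ENNReal) ≠ ⊤) := ⟨by simp⟩
  have hsc : SecondCountableTopology (Lp ℝ 2 μ) := inferInstance
  obtain ⟨L, -, k, hk, hL⟩ := WeakDual.isSeqCompact_closedBall ℝ (Lp ℝ 2 μ) 0 D hΛ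
  set W : Lp ℝ 2 μ := (InnerProductSpace.toDual ℝ (Lp ℝ 2 μ)).symm (WeakDual.toStrongDual L) with hW
  have hWm : AEStronglyMeasurable W μ := (Lp.memLp W).1
  set w : α → ℝ := hWm.mk W with hw
  have hwW : (W : α → ℝ) =ᵐ[μ] w := hWm.ae_eq_mk
  have hwm : Measurable w := hWm.stronglyMeasurable_mk.measurable
  have hconv : ∀ (f : α → ℝ) (C : ℝ), Measurable f → (∀ p, |f p| ≤ C) →
        Tendsto (fun n => ∫ p, z (k n) p * f p ∂μ) atTop (𝓝 (∫ p, w p * f p ∂μ)) := by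
    intro f C hf hC
    have hfm : MemLp f 2 μ := MemLp.of_bound hf.aestronglyMeasurable C (ae_of_all _ hC)
    have h1 : Tendsto (fun n => Λ (k n) hfm.toLp) atTop (𝓝 (L hfm.toLp)) :=
      ((WeakDual.eval_continuous _).tendsto L).comp hL
    have h2 : ∀ n, Λ n hfm.toLp = ∫ p, z n p * f p ∂μ := by
      intro n
      change (InnerProductSpace.toDual ℝ (Lp ℝ 2 μ) (Z n)) hfm.toLp = _
      rw [InnerProductSpace.toDual_apply_apply, L2.inner_def]
      refine integral_congr_ae ?_
      filter_upwards [(hmem n).coeFn_toLp, hfm.coeFn_toLp] with p h3 h4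
      change inner ℝ ((((hmem n).toLp : Lp ℝ 2 μ) : α → ℝ) p) (((hfm.toLp : Lp ℝ 2 μ) : α → ℝ) p) = _
      rw [h3, h4]
      simp [mul_comm]
    have h3 : L hfm.toLp = ∫ p, w p * f p ∂μ := by
      have : L hfm.toLp = inner ℝ W hfm.toLp := by
        rw [← InnerProductSpace.toDual_apply_apply, hW, LinearIsometryEquiv.apply_symm_apply]
        rfl
      rw [this, L2.inner_def]
      refine integral_congr_ae ?_
      filter_upwards [hwW, hfm.coeFn_toLp] with p h3 h4
      rw [h3, h4]
      simp [mul_comm]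
    simp_rw [h2] at h1
    rwa [h3] at h1
  refine ⟨w, k, hk, hwm, ?_, hconv⟩
  have hwi : Integrable w μ := ((Lp.memLp W).integrable (by norm_num)).congr hwW
  -- The weak `L²` limit is only known to be square integrable; testing with indicators recovers the
  -- bound `1` almost everywhere.
  have hset : ∀ S, MeasurableSet S → |∫ p in S, w p ∂μ| ≤ (μ S).toReal := by
    intro S hS
    have h1 := hconv (S.indicator 1) 1 (measurable_one.indicator hS) (fun p => by
      by_cases hp : p ∈ S <;> simp [hp])
    have e : ∀ f : α → ℝ, ∫ p, f p * S.indicator (1 : α → ℝ) p ∂μ = ∫ p in S, f p ∂μ := by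
      intro f
      rw [← integral_indicator hS]
      congr 1; ext p
      by_cases hp : p ∈ S <;> simp [hp]
    simp_rw [e] at h1
    refine le_of_tendsto' h1.abs fun n => ?_
    rw [← Real.norm_eq_abs]
    have := norm_setIntegral_le_of_norm_le_const (measure_lt_top μ S) (f := z (k n)) (C := 1)
      (fun p _ => hz1 _ p)
    simpa [Measure.real] using this
  have hle := ae_le_of_forall_setIntegral_le hwi (integrable_const (1 : ℝ)) (fun S hS _ => by
    rw [setIntegral_const]
    have := (abs_le.1 (hset S hS)).2
    simpa [Measure.real] using this)
  have hge := ae_le_of_forall_setIntegral_le (integrable_const (-1 : ℝ)) hwi (fun S hS _ => by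
    rw [setIntegral_const]
    have := (abs_le.1 (hset S hS)).1
    simpa [Measure.real] using this)
  filter_upwards [hle, hge] with p h1 h2
  exact abs_le.2 ⟨h2, h1⟩

/-- Weak compactness of the unit ball of `L^∞` tested against functions dominated by a fixed
positive integrable function. -/
lemma exists_subseq_weak_density {α : Type*} [MeasurableSpace α]
    [MeasurableSpace.CountablyGenerated α] (μ : Measure α) {ρ : α → ℝ} (hρm : Measurable ρ)
    (hρi : Integrable ρ μ) (hρ0 : ∀ p, 0 ≤ ρ p) (hρ : ∀ᵐ p ∂μ, 0 < ρ p)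
    (z : ℕ → α → ℝ) (hz : ∀ n, Measurable (z n))
    (hz1 : ∀ n p, |z n p| ≤ 1) :
    ∃ (w : α → ℝ) (k : ℕ → ℕ), StrictMono k ∧ Measurable w ∧ (∀ᵐ p ∂μ, |w p| ≤ 1) ∧
      ∀ (f : α → ℝ) (C : ℝ), Measurable f → (∀ p, |f p| ≤ C * ρ p) →
        Tendsto (fun n => ∫ p, z (k n) p * f p ∂μ) atTop (𝓝 (∫ p, w p * f p ∂μ)) := by
  set m := μ.withDensity fun p => ENNReal.ofReal (ρ p) with hm
  have hfin : IsFiniteMeasure m := isFiniteMeasure_withDensity_ofReal hρi.2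
  obtain ⟨w, k, hk, hwm, hw1, hconv⟩ := exists_subseq_weak m z hz hz1
  have hac : μ ≪ m := withDensity_absolutelyContinuous' hρm.ennreal_ofReal.aemeasurable (by
    filter_upwards [hρ] with p hp
    simpa using hp)
  refine ⟨w, k, hk, hwm, hac.ae_le hw1, fun f C hf hC => ?_⟩
  -- Relative to the finite measure `ρ μ`, the test function `f` becomes the bounded function `f /
  -- ρ`.
  have h1 := hconv (fun p => f p / ρ p) |C| (hf.div hρm) (fun p => by
    rw [abs_div, abs_of_nonneg (hρ0 p)]
    rcases (hρ0 p).eq_or_lt with h | h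
    · rw [← h]; simp
    · rw [div_le_iff₀ h]
      exact (hC p).trans (mul_le_mul_of_nonneg_right (le_abs_self C) h.le))
  have e : ∀ v : α → ℝ, ∫ p, v p * (f p / ρ p) ∂m = ∫ p, v p * f p ∂μ := by
    intro v
    rw [hm, integral_withDensity_eq_integral_toReal_smul hρm.ennreal_ofReal (by simp)]
    refine integral_congr_ae ?_
    filter_upwards [hρ] with p hp
    rw [ENNReal.toReal_ofReal hp.le, smul_eq_mul]
    field_simp
  simp_rw [e] at h1
  exact h1

/-! ### Passage to the limit -/

section limit

variable {N : ℕ} {s h : ℝ}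

/-- A positive integrable weight on `ℝ^N`. -/
noncomputable def weight (x : Euc N) : ℝ := (1 + ‖x‖) ^ (-((N : ℝ) + 1))

lemma weight_pos (x : Euc N) : 0 < weight x := by unfold weight; positivity

lemma measurable_weight : Measurable (weight : Euc N → ℝ) := by unfold weight; fun_prop

lemma integrable_weight : Integrable (weight : Euc N → ℝ) :=
  integrable_one_add_norm (by simp)

/-- A positive integrable density on `ℝ^N × ℝ^N` dominating the difference quotients of test
functions. -/
noncomputable def density (N : ℕ) (s : ℝ) (p : Euc N × Euc N) : ℝ :=
  (weight p.1 + weight p.2) * (min 1 ‖p.1 - p.2‖ * ker s (p.1 - p.2))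

lemma density_nonneg (p : Euc N × Euc N) : 0 ≤ density N s p :=
  mul_nonneg (add_pos (weight_pos _) (weight_pos _)).le
    (mul_nonneg (le_min zero_le_one (norm_nonneg _)) (ker_nonneg _))

lemma measurable_density : Measurable (density N s) := by
  have h1 := measurable_ker (N := N) (s := s)
  have h2 := measurable_weight (N := N)
  unfold density
  fun_prop

lemma integrable_density (hN : 1 ≤ N) (hs0 : 0 < s) (hs1 : s < 1) :
    Integrable (density N s) := by
  have hK := integrable_min_ker hN hs0 hs1
  have h1 := integrable_prod_mul_sub' (integrable_weight (N := N)) hK (by intro v; simp [ker_neg])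
  have h2 := integrable_prod_mul_sub (integrable_weight (N := N)) hK
  refine (h1.add h2).congr (ae_of_all _ fun p => ?_)
  simp only [density, Pi.add_apply]; ring

lemma ae_fst_ne_snd (hN : 1 ≤ N) : ∀ᵐ p : Euc N × Euc N, p.1 ≠ p.2 := by
  have := euc_nontrivial hN
  have hm : MeasurableSet {p : Euc N × Euc N | p.1 = p.2} :=
    measurableSet_eq_fun measurable_fst measurable_snd
  rw [ae_iff]
  simp only [ne_eq, not_not]
  rw [Measure.volume_eq_prod, Measure.measure_prod_null hm]
  refine ae_of_all _ fun x => ?_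
  have : Prod.mk x ⁻¹' {p : Euc N × Euc N | p.1 = p.2} = {x} := by
    ext y; simp [eq_comm]
  simp only [this, measure_singleton, Pi.zero_apply]

lemma density_pos (hN : 1 ≤ N) : ∀ᵐ p, 0 < density N s p := by
  filter_upwards [ae_fst_ne_snd hN] with p hp
  have h1 : 0 < ‖p.1 - p.2‖ := norm_pos_iff.2 (sub_ne_zero.2 hp)
  have := weight_pos p.1
  have := weight_pos p.2
  unfold density ker
  positivity

lemma indicator_le_weight (R : ℝ) (x : Euc N) :
    (Metric.closedBall (0 : Euc N) R).indicator (1 : Euc N → ℝ) x ≤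
      (1 + |R|) ^ ((N : ℝ) + 1) * weight x := by
  by_cases hx : x ∈ Metric.closedBall (0 : Euc N) R
  · rw [Set.indicator_of_mem hx, Pi.one_apply, weight, Real.rpow_neg (by positivity),
      ← div_eq_mul_inv, one_le_div (by positivity)]
    have := mem_closedBall_zero_iff.1 hx
    have := le_abs_self R
    exact Real.rpow_le_rpow (by positivity) (by linarith) (by positivity)
  · rw [Set.indicator_of_notMem hx]
    have := weight_pos x
    positivity

lemma majorant_le_density (R : ℝ) (p : Euc N × Euc N) :
    majorant N s R p ≤ (1 + |R|) ^ ((N : ℝ) + 1) * density N s p := by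
  unfold majorant density
  rw [← mul_assoc ((1 + |R|) ^ ((N : ℝ) + 1)), mul_add]
  exact mul_le_mul_of_nonneg_right
    (add_le_add (indicator_le_weight R p.1) (indicator_le_weight R p.2))
    (mul_nonneg (le_min zero_le_one (norm_nonneg _)) (ker_nonneg _))

/-- `1`-Lipschitz solutions of the ROF problem with datum `|x|`, tested against Lipschitz functions
and against sets of finite perimeter. -/
structure CalibratedSol (s h B : ℝ) (u : Euc N → ℝ) (z : Euc N × Euc N → ℝ) : Prop where
  lip : ∀ x y, u x ≤ u y + ‖x - y‖
  ge : ∀ x, ‖x‖ ≤ u x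
  le : ∀ x, u x ≤ ‖x‖ + B
  meas : Measurable z
  bdd : ∀ᵐ p, |z p| ≤ 1
  align : ∀ᵐ p, z p * (u p.1 - u p.2) = |u p.1 - u p.2|
  weak : ∀ (C ρ : ℝ) (ψ : Euc N → ℝ), IsTest C ρ ψ →
    h * (cs N s / 2 * ∫ p, z p * dq s ψ p) + ∫ x, u x * ψ x = ∫ x, ‖x‖ * ψ x
  calib : ∀ F : Set (Euc N), MeasurableSet F → volume F ≠ ⊤ → perimeter s F ≠ ⊤ →
    ∫ x in F, (u x - ‖x‖) ≤ h * (perimeter s F).toReal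

/-- The equation and the calibration inequality pass to the limit by linearity in the field and
dominated convergence. Only the alignment is nonlinear; it survives because the fields converge
weakly while the differences of the `U n` converge strongly in a weighted `L¹`. -/
lemma exists_calibratedSol (hN : 1 ≤ N) (hs0 : 0 < s) (hs1 : s < 1) (hh : 0 < h) :
    ∃ (B : ℝ) (u : Euc N → ℝ) (z : Euc N × Euc N → ℝ), CalibratedSol s h B u z := by
  obtain ⟨B, hB⟩ := ApproxSol.le_add (N := N) hN hs0 hs1 hh
  choose U Z hUZ using fun n => exists_approxSol (N := N) hN hs0 hs1 hh n
  obtain ⟨u, k, hk, hu⟩ := exists_subseq_pointwise U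
    (fun n x y => by rw [dist_eq_norm]; exact (hUZ n).lip x y) (fun x => ‖x‖) (fun x => ‖x‖ + B)
    (fun n x => ⟨(hUZ n).ge x, hB n _ _ (hUZ n) x⟩)
  obtain ⟨w, l, hl, hwm, hw1, hconv⟩ := exists_subseq_weak_density volume
    (measurable_density (N := N) (s := s)) (integrable_density hN hs0 hs1) density_nonneg
    (density_pos hN) (fun n => Z (k n)) (fun n => (hUZ _).meas) (fun n => (hUZ _).bdd)
  set j : ℕ → ℕ := fun n => k (l n) with hj
  have hjm : StrictMono j := hk.comp hl
  have huj : ∀ x, Tendsto (fun n => U (j n) x) atTop (𝓝 (u x)) := fun x =>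
    (hu x).comp hl.tendsto_atTop
  have hlip : ∀ x y, u x ≤ u y + ‖x - y‖ := fun x y =>
    le_of_tendsto_of_tendsto' (huj x) ((huj y).add_const _) fun n => (hUZ _).lip x y
  have hge : ∀ x, ‖x‖ ≤ u x := fun x => ge_of_tendsto' (huj x) fun n => (hUZ _).ge x
  have hle : ∀ x, u x ≤ ‖x‖ + B := fun x =>
    le_of_tendsto' (huj x) fun n => hB _ _ _ (hUZ _) x
  have huc := continuous_of_le_add_norm hlip
  have hUc : ∀ n, Continuous (U n) := fun n => continuous_of_le_add_norm (hUZ n).lip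
  have hdist : ∀ n x, |U n x - u x| ≤ B := fun n x => by
    have h1 := (hUZ n).ge x
    have h2 := hB n _ _ (hUZ n) x
    have h3 := hge x
    have h4 := hle x
    exact abs_le.2 ⟨by linarith, by linarith⟩
  refine ⟨B, u, w, hlip, hge, hle, hwm, hw1, ?_, ?_, ?_⟩
  · set du : Euc N × Euc N → ℝ := fun p => u p.1 - u p.2 with hdu
    have hduc : Continuous du := by fun_prop
    -- The denominator keeps both `θ` and `|du| θ` below the integrable density, so `du θ` is an
    -- admissible test function for the weak convergence.
    set θ : Euc N × Euc N → ℝ := fun p => density N s p / (1 + |du p|) with hθ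
    have hθ0 : ∀ p, 0 ≤ θ p := fun p => div_nonneg (density_nonneg p) (by positivity)
    have hθm : Measurable θ := measurable_density.div (by fun_prop)
    have hθd : ∀ p, |du p| * θ p ≤ density N s p := fun p => by
      simp only [hθ]
      rw [mul_div_assoc', div_le_iff₀ (by positivity)]
      have := density_nonneg (s := s) p
      nlinarith [abs_nonneg (du p)]
    have hθd' : ∀ p, θ p ≤ density N s p := fun p =>
      div_le_self (density_nonneg p) (by linarith [abs_nonneg (du p)])
    have hdi := integrable_density (N := N) hN hs0 hs1
    have hθi : Integrable θ := hdi.mono' hθm.aestronglyMeasurable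
      (ae_of_all _ fun p => by rw [Real.norm_of_nonneg (hθ0 p)]; exact hθd' p)
    have hdθ : Integrable (fun p => |du p| * θ p) := hdi.mono'
      (hduc.abs.measurable.mul hθm).aestronglyMeasurable
      (ae_of_all _ fun p => by
        rw [Real.norm_of_nonneg (mul_nonneg (abs_nonneg _) (hθ0 p))]; exact hθd p)
    have hdθ' : Integrable (fun p => du p * θ p) := hdθ.mono
      (hduc.measurable.mul hθm).aestronglyMeasurable (ae_of_all _ fun p => by simp)
    have h1 := hconv (fun p => du p * θ p) 1 (hduc.measurable.mul hθm) (fun p => by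
      rw [abs_mul, abs_of_nonneg (hθ0 p), one_mul]; exact hθd p)
    -- Error bound: `1/(j n + 1)` comes from the approximate alignment, and the other term from
    -- replacing the difference of `U (j n)` by `du` twice, in the absolute value and in the
    -- product.
    set E : ℕ → Euc N × Euc N → ℝ := fun n p =>
      (1 / ((j n : ℝ) + 1) + 2 * |du p - (U (j n) p.1 - U (j n) p.2)|) * θ p with hE
    have hEc : ∀ n, Continuous fun p : Euc N × Euc N =>
        1 / ((j n : ℝ) + 1) + 2 * |du p - (U (j n) p.1 - U (j n) p.2)| := fun n => by
      have := hUc (j n); fun_prop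
    have hEb : ∀ n p, ‖E n p‖ ≤ (1 + 2 * (2 * B)) * θ p := by
      intro n p
      have h2 := hdist (j n) p.1
      have h3 := hdist (j n) p.2
      have h4 : |du p - (U (j n) p.1 - U (j n) p.2)| ≤ 2 * B := by
        rw [abs_le] at *
        constructor <;> simp only [hdu] <;> linarith
      have h5 : 1 / ((j n : ℝ) + 1) ≤ 1 := by
        rw [div_le_one (by positivity)]; linarith [(Nat.cast_nonneg (j n) : (0 : ℝ) ≤ j n)]
      rw [Real.norm_of_nonneg (mul_nonneg (by positivity) (hθ0 p))]
      exact mul_le_mul_of_nonneg_right (by linarith) (hθ0 p)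
    have hEm : ∀ n, AEStronglyMeasurable (E n) volume := fun n =>
      ((hEc n).measurable.mul hθm).aestronglyMeasurable
    have hEi : ∀ n, Integrable (E n) := fun n =>
      (hθi.const_mul _).mono' (hEm n) (ae_of_all _ (hEb n))
    have hE0 : Tendsto (fun n => ∫ p, E n p) atTop (𝓝 0) := by
      have : Tendsto (fun n => ∫ p, E n p) atTop (𝓝 (∫ p : Euc N × Euc N, (0 : ℝ))) := by
        refine tendsto_integral_of_dominated_convergence _ hEm (hθi.const_mul _)
          (fun n => ae_of_all _ (hEb n)) (ae_of_all _ fun p => ?_)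
        have e1 : Tendsto (fun n => 1 / ((j n : ℝ) + 1)) atTop (𝓝 0) :=
          tendsto_one_div_add_atTop_nhds_zero_nat.comp hjm.tendsto_atTop
        have e2 := ((huj p.1).sub (huj p.2)).const_sub (du p)
        have e3 := (e1.add (e2.abs.const_mul 2)).mul_const (θ p)
        simpa [hdu, hE] using e3
      simpa using this
    have hlow : ∀ n, (∫ p, |du p| * θ p) - ∫ p, E n p ≤ ∫ p, Z (j n) p * (du p * θ p) := by
      intro n
      rw [← integral_sub hdθ (hEi n)]
      refine integral_mono (hdθ.sub (hEi n))
        (hdθ'.bdd_mul (hUZ _).meas.aestronglyMeasurable (ae_of_all _ (hUZ (j n)).bdd)) fun p => ?_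
      simp only [hE]
      rw [← sub_mul, ← mul_assoc]
      refine mul_le_mul_of_nonneg_right ?_ (hθ0 p)
      have ha := (hUZ (j n)).align p
      have hb := (hUZ (j n)).bdd p
      set d := U (j n) p.1 - U (j n) p.2
      have h6 : |Z (j n) p * (du p - d)| ≤ |du p - d| := by
        rw [abs_mul]; exact mul_le_of_le_one_left (abs_nonneg _) hb
      have h7 := (abs_le.1 h6).1
      have h8 : |du p| ≤ |d| + |du p - d| := by
        have := abs_add_le d (du p - d)
        rwa [add_sub_cancel] at this
      nlinarith
    have h2 : ∫ p, |du p| * θ p ≤ ∫ p, w p * (du p * θ p) := by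
      have := le_of_tendsto_of_tendsto' (hE0.const_sub (∫ p, |du p| * θ p)) h1 hlow
      simpa using this
    have hwi : Integrable (fun p => w p * (du p * θ p)) :=
      hdθ'.bdd_mul hwm.aestronglyMeasurable hw1
    have hpt : ∀ᵐ p, 0 ≤ |du p| * θ p - w p * (du p * θ p) := by
      filter_upwards [hw1] with p hp
      rw [← mul_assoc, ← sub_mul]
      refine mul_nonneg ?_ (hθ0 p)
      have : |w p * du p| ≤ |du p| := by
        rw [abs_mul]; exact mul_le_of_le_one_left (abs_nonneg _) hp
      linarith [(abs_le.1 this).2]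
    -- Pointwise `w du ≤ |du|`, while the integrals against `θ` satisfy the reverse inequality;
    -- since `θ > 0` almost everywhere, equality holds almost everywhere.
    have h3 := (integral_eq_zero_iff_of_nonneg_ae hpt (hdθ.sub hwi)).1 (le_antisymm (by
      rw [integral_sub hdθ hwi]; linarith) (integral_nonneg_of_ae hpt))
    filter_upwards [h3, density_pos (s := s) hN] with p h4 h5
    have h6 : 0 < θ p := div_pos h5 (by positivity)
    simp only [Pi.zero_apply] at h4
    rw [← mul_assoc, ← sub_mul, mul_eq_zero] at h4
    rcases h4 with h4 | h4
    · simp only [hdu] at h4; linarith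
    · exact absurd h4 h6.ne'
  · intro C ρ ψ hψ
    have hC := hψ.const_nonneg hN
    have h1 := hconv (dq s ψ) (C * (1 + |ρ|) ^ ((N : ℝ) + 1))
      (measurable_dq (hψ.continuous hN).measurable) (fun p => by
        rw [mul_assoc]
        exact (hψ.abs_dq_le hN p).trans (mul_le_mul_of_nonneg_left (majorant_le_density ρ p) hC))
    have h2 : Tendsto (fun n => ∫ x, U (j n) x * ψ x) atTop (𝓝 (∫ x, u x * ψ x)) := by
      refine tendsto_integral_of_dominated_convergence (fun x => (‖x‖ + B) * |ψ x|)
        (fun n => (hψ.integrable_mul hN (hUc _)).aestronglyMeasurable) ?_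
        (fun n => ae_of_all _ fun x => ?_) (ae_of_all _ fun x => (huj x).mul_const _)
      · have := (hψ.integrable_mul hN (f := fun x => ‖x‖ + B) (by fun_prop)).abs
        refine this.congr (ae_of_all _ fun x => ?_)
        simp only
        rw [abs_mul, abs_of_nonneg ((norm_nonneg x).trans ((hge x).trans (hle x)))]
      · have h3 := (hUZ (j n)).ge x
        rw [norm_mul, Real.norm_eq_abs, Real.norm_eq_abs,
          abs_of_nonneg ((norm_nonneg x).trans h3)]
        exact mul_le_mul_of_nonneg_right (hB _ _ _ (hUZ _) x) (abs_nonneg _)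
    have h3 := ((h1.const_mul (cs N s / 2)).const_mul h).add h2
    have h4 : ∀ n, h * (cs N s / 2 * ∫ p, Z (k (l n)) p * dq s ψ p) + ∫ x, U (j n) x * ψ x =
      ∫ x, ‖x‖ * ψ x := fun n => (hUZ (j n)).weak C ρ ψ hψ
    simp_rw [h4] at h3
    exact (tendsto_nhds_unique h3 tendsto_const_nhds)
  · intro F hF hFv hP
    have h1 : Tendsto (fun n => ∫ x in F, (U (j n) x - ‖x‖)) atTop
        (𝓝 (∫ x in F, (u x - ‖x‖))) := by
      refine tendsto_integral_of_dominated_convergence (fun _ => B)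
        (fun n => ((hUc _).sub continuous_norm).aestronglyMeasurable)
        (integrableOn_const hFv)
        (fun n => ae_of_all _ fun x => ?_) (ae_of_all _ fun x => (huj x).sub_const _)
      have h2 := (hUZ (j n)).ge x
      have h3 := hB _ _ _ (hUZ (j n)) x
      rw [Real.norm_of_nonneg (by linarith)]; linarith
    exact le_of_tendsto' h1 fun n => (hUZ _).calib F hF hFv hP

end limit

/-! ### Comparison and uniqueness -/

section weakSol

variable {N : ℕ} {s h : ℝ}

lemma exists_isTest {ψ : Euc N → ℝ} {K : NNReal} (hψ : LipschitzWith K ψ)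
    (hc : HasCompactSupport ψ) : ∃ C ρ, IsTest C ρ ψ := by
  obtain ⟨M, hM⟩ := hc.exists_bound_of_continuous hψ.continuous
  obtain ⟨ρ, hρ⟩ := hc.isCompact.isBounded.subset_closedBall (0 : Euc N)
  have hM0 : 0 ≤ M := (norm_nonneg _).trans (hM 0)
  refine ⟨K + 2 * M, ρ, fun x y => ?_, fun x hx => ?_⟩
  · have h1 := hψ.dist_le_mul x y
    rw [Real.dist_eq, dist_eq_norm] at h1
    have hK : (0 : ℝ) ≤ K := K.2
    rcases le_total 1 ‖x - y‖ with h2 | h2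
    · rw [min_eq_left h2, mul_one]
      have h3 := abs_sub (ψ x) (ψ y)
      have h4 := hM x
      have h5 := hM y
      rw [Real.norm_eq_abs] at h4 h5
      linarith
    · rw [min_eq_right h2, add_mul]
      have : 0 ≤ 2 * M * ‖x - y‖ := by positivity
      linarith
  · refine image_eq_zero_of_notMem_tsupport fun hx' => ?_
    have := mem_closedBall_zero_iff.1 (hρ hx')
    linarith

/-- Solutions of the ROF problem with datum `|x|`, tested against Lipschitz functions. -/
structure WeakSol (s h : ℝ) (u : Euc N → ℝ) (z : Euc N × Euc N → ℝ) : Prop where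
  mem : u ∈ LPlus N
  meas : AEStronglyMeasurable z volume
  bdd : ∀ᵐ p, |z p| ≤ 1
  align : ∀ᵐ p, z p * (u p.1 - u p.2) = |u p.1 - u p.2|
  weak : ∀ (C ρ : ℝ) (ψ : Euc N → ℝ), IsTest C ρ ψ →
    h * (cs N s / 2 * ∫ p, z p * dq s ψ p) + ∫ x, u x * ψ x = ∫ x, ‖x‖ * ψ x

lemma continuous_of_mem_LPlus {u : Euc N → ℝ} (hu : u ∈ LPlus N) : Continuous u := by
  obtain ⟨⟨K, hK⟩, -⟩ := hu
  exact hK.continuous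

lemma isROFSolution_iff (hN : 1 ≤ N) (hs0 : 0 < s) (hs1 : s < 1) {u : Euc N → ℝ} :
    IsROFSolution s h (fun x => ‖x‖) u ↔ ∃ z, WeakSol s h u z := by
  constructor
  · rintro ⟨hu, z, hz, hz1, hzu, hw⟩
    exact ⟨z, hu, hz, hz1, hzu, fun C ρ ψ hψ => weak_of_smooth hN hs0 hs1 continuous_norm
      (continuous_of_mem_LPlus hu) hz hz1 hw hψ⟩
  · rintro ⟨z, hu, hz, hz1, hzu, hw⟩
    refine ⟨hu, z, hz, hz1, hzu, fun ψ hψ hc => ?_⟩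
    obtain ⟨K, hK⟩ := ContDiff.lipschitzWith_of_hasCompactSupport hc hψ (by simp)
    obtain ⟨C, ρ, ht⟩ := exists_isTest hK hc
    rw [← hw C ρ ψ ht]
    unfold divPairing dq
    ring

lemma mem_LPlus_of_norm_le {u : Euc N → ℝ} {K : NNReal} (h1 : LipschitzWith K u)
    (h2 : ∀ x, ‖x‖ ≤ u x) : u ∈ LPlus N :=
  ⟨⟨K, h1⟩, tendsto_atTop_mono h2 (tendsto_norm_cocompact_atTop)⟩

lemma CalibratedSol.lipschitz {B : ℝ} {u : Euc N → ℝ} {z : Euc N × Euc N → ℝ}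
    (hu : CalibratedSol s h B u z) : LipschitzWith 1 u :=
  LipschitzWith.of_le_add fun x y => by rw [dist_eq_norm]; exact hu.lip x y

lemma CalibratedSol.weakSol {B : ℝ} {u : Euc N → ℝ} {z : Euc N × Euc N → ℝ}
    (hu : CalibratedSol s h B u z) : WeakSol s h u z :=
  ⟨mem_LPlus_of_norm_le hu.lipschitz hu.ge, hu.meas.aestronglyMeasurable, hu.bdd, hu.align,
    hu.weak⟩

/-- If the first truncated difference exceeds the second, then `a > b`, which forces `z₁ = 1`, or `c
< d`, which forces `z₂ = -1`. Either way `z₂ ≤ z₁`; the opposite case is symmetric. This is the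
monotonicity behind comparison. -/
lemma mul_trunc_le {z₁ z₂ a b c d M : ℝ} (hz₁ : |z₁| ≤ 1) (hz₂ : |z₂| ≤ 1)
    (h₁ : z₁ * (a - b) = |a - b|) (h₂ : z₂ * (c - d) = |c - d|) :
    z₂ * (max 0 (min a M - c) - max 0 (min b M - d)) ≤
      z₁ * (max 0 (min a M - c) - max 0 (min b M - d)) := by
  rw [abs_le] at hz₁ hz₂
  have one_of : ∀ z t : ℝ, z * t = |t| → 0 < t → z = 1 := fun z t h ht => by
    rw [abs_of_pos ht] at h
    exact mul_right_cancel₀ ht.ne' (h.trans (one_mul t).symm)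
  have neg_one_of : ∀ z t : ℝ, z * t = |t| → t < 0 → z = -1 := fun z t h ht => by
    rw [abs_of_neg ht] at h
    exact mul_right_cancel₀ ht.ne (h.trans (neg_one_mul t).symm)
  rcases lt_trichotomy (max 0 (min a M - c)) (max 0 (min b M - d)) with hlt | heq | hgt
  · have : a < b ∨ d < c := by grind
    have hz : z₁ ≤ z₂ := by
      rcases this with h | h
      · rw [neg_one_of z₁ _ h₁ (by linarith)]; exact hz₂.1
      · rw [one_of z₂ _ h₂ (by linarith)]; exact hz₁.2
    nlinarith
  · rw [heq]; simp
  · have : b < a ∨ c < d := by grind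
    have hz : z₂ ≤ z₁ := by
      rcases this with h | h
      · rw [one_of z₁ _ h₁ (by linarith)]; exact hz₂.2
      · rw [neg_one_of z₂ _ h₂ (by linarith)]; exact hz₁.1
    nlinarith

/-- The solution `u` may grow faster than `w`. Cutting it at height `M` makes the support compact,
since `w` eventually exceeds `M`. -/
lemma isTest_trunc {u w : Euc N → ℝ} (hu : u ∈ LPlus N) (hw : w ∈ LPlus N) (M : ℝ) :
    ∃ C ρ, IsTest C ρ (fun x => max 0 (min (u x) M - w x)) := by
  obtain ⟨⟨K, hK⟩, -⟩ := hu
  obtain ⟨⟨L, hL⟩, ht⟩ := hw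
  refine exists_isTest (((hK.min_const M).sub hL).const_max 0) ?_
  rw [hasCompactSupport_iff_eventuallyEq, coclosedCompact_eq_cocompact]
  filter_upwards [ht.eventually_ge_atTop M] with x hx
  simp only [Pi.zero_apply]
  exact max_eq_left (by linarith [min_le_right (u x) M])

/-- Comparison of a solution with a function `w` aligned with a field `z₂`. -/
lemma WeakSol.le_of_aligned (hN : 1 ≤ N) (hs0 : 0 < s) (hs1 : s < 1) (hh : 0 < h)
    {u w : Euc N → ℝ} {z z₂ : Euc N × Euc N → ℝ} (hu : WeakSol s h u z)
    (hz₂ : AEStronglyMeasurable z₂ volume) (hz₂b : ∀ᵐ p, |z₂ p| ≤ 1)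
    (hz₂w : ∀ᵐ p, z₂ p * (w p.1 - w p.2) = |w p.1 - w p.2|) {C ρ M : ℝ}
    (ht : IsTest C ρ (fun x => max 0 (min (u x) M - w x))) :
    h * (cs N s / 2 * ∫ p, z₂ p * dq s (fun x => max 0 (min (u x) M - w x)) p) +
      ∫ x, u x * max 0 (min (u x) M - w x) ≤ ∫ x, ‖x‖ * max 0 (min (u x) M - w x) := by
  rw [← hu.weak C ρ _ ht]
  have hc := cs_pos (N := N) hs1
  gcongr 1
  refine mul_le_mul_of_nonneg_left (mul_le_mul_of_nonneg_left ?_ (by positivity)) hh.le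
  refine integral_mono_ae (ht.integrable_mul_dq hN hs0 hs1 hz₂ hz₂b)
    (ht.integrable_mul_dq hN hs0 hs1 hu.meas hu.bdd) ?_
  filter_upwards [hz₂b, hz₂w, hu.bdd, hu.align] with p h1 h2 h3 h4
  simp only [dq_eq]
  rw [← mul_assoc, ← mul_assoc]
  exact mul_le_mul_of_nonneg_right (mul_trunc_le h3 h1 h4 h2) (ker_nonneg _)

/-- If `u` exceeds `f` on the support of a truncated difference, the latter vanishes. -/
lemma trunc_eq_zero_of_integral_nonpos (hN : 1 ≤ N) {ψ f : Euc N → ℝ} {C ρ : ℝ}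
    (ht : IsTest C ρ ψ) (hf : Continuous f) (hpos : ∀ x, 0 < ψ x → 0 < f x) (hψ : ∀ x, 0 ≤ ψ x)
    (hi : ∫ x, f x * ψ x ≤ 0) (x : Euc N) : ψ x = 0 := by
  have hnn : ∀ x, 0 ≤ f x * ψ x := fun x => by
    rcases (hψ x).eq_or_lt with h0 | h0
    · rw [← h0]; simp
    · exact mul_nonneg (hpos x h0).le h0.le
  have hc : Continuous fun x => f x * ψ x := hf.mul (ht.continuous hN)
  by_contra hx
  have h1 : 0 < ψ x := lt_of_le_of_ne (hψ x) (Ne.symm hx)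
  have := hc.integral_pos_of_hasCompactSupport_nonneg_nonzero (μ := volume)
    ht.hasCompactSupport.mul_left hnn (x := x) (mul_pos (hpos x h1) h1).ne'
  linarith

/-- Both equations are tested with the truncated positive part of `u - w`. The field terms are
ordered, which leaves `∫ (u - w) ψ ≤ 0` with `u > w` wherever `ψ > 0`, so `ψ` vanishes. The
truncation level is finally taken to be `u x`. -/
lemma WeakSol.le (hN : 1 ≤ N) (hs0 : 0 < s) (hs1 : s < 1) (hh : 0 < h) {u w : Euc N → ℝ}
    {z z₂ : Euc N × Euc N → ℝ} (hu : WeakSol s h u z) (hw : WeakSol s h w z₂) (x : Euc N) :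
    u x ≤ w x := by
  have hucont := continuous_of_mem_LPlus hu.mem
  have hwcont := continuous_of_mem_LPlus hw.mem
  have key : ∀ M, min (u x) M ≤ w x := by
    intro M
    obtain ⟨C, ρ, ht⟩ := isTest_trunc hu.mem hw.mem M
    have h1 := hu.le_of_aligned hN hs0 hs1 hh hw.meas hw.bdd hw.align ht
    have h2 := hw.weak C ρ _ ht
    have h3 : ∫ x, (u x - w x) * max 0 (min (u x) M - w x) ≤ 0 := by
      simp_rw [sub_mul]
      rw [integral_sub (ht.integrable_mul hN hucont) (ht.integrable_mul hN hwcont)]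
      linarith
    have h4 := trunc_eq_zero_of_integral_nonpos hN ht (f := fun x => u x - w x)
      (hucont.sub hwcont) (fun x hx => ?_) (fun x => le_max_left _ _) h3 x
    · have := le_max_right 0 (min (u x) M - w x)
      linarith
    · have := min_le_left (u x) M
      simp only [lt_max_iff, lt_irrefl, false_or] at hx
      linarith
  simpa using key (u x)

lemma exists_isROFSolution (hN : 1 ≤ N) (hs0 : 0 < s) (hs1 : s < 1) (hh : 0 < h) :
    ∃ φ : Euc N → ℝ, IsROFSolution s h (fun x => ‖x‖) φ := by
  obtain ⟨B, u, z, hu⟩ := exists_calibratedSol (N := N) hN hs0 hs1 hh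
  exact ⟨u, (isROFSolution_iff hN hs0 hs1).2 ⟨z, hu.weakSol⟩⟩

lemma WeakSol.eq (hN : 1 ≤ N) (hs0 : 0 < s) (hs1 : s < 1) (hh : 0 < h) {u w : Euc N → ℝ}
    {z z₂ : Euc N × Euc N → ℝ} (hu : WeakSol s h u z) (hw : WeakSol s h w z₂) : u = w :=
  funext fun x => le_antisymm (hu.le hN hs0 hs1 hh hw x) (hw.le hN hs0 hs1 hh hu x)

/-- By uniqueness every solution inherits the Lipschitz constant 1, the lower bound and the
calibration inequality of the constructed one. The field may change. -/
lemma WeakSol.exists_calibratedSol (hN : 1 ≤ N) (hs0 : 0 < s) (hs1 : s < 1) (hh : 0 < h)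
    {u : Euc N → ℝ} {z : Euc N × Euc N → ℝ} (hu : WeakSol s h u z) :
    ∃ B z', CalibratedSol s h B u z' := by
  obtain ⟨B, w, z', hw⟩ := FracFlow.exists_calibratedSol (N := N) hN hs0 hs1 hh
  obtain rfl := hu.eq hN hs0 hs1 hh hw.weakSol
  exact ⟨B, z', hw⟩

/-- A quantitative bound at the origin for every solution. -/
lemma WeakSol.apply_zero_le (hN : 1 ≤ N) (hs0 : 0 < s) (hs1 : s < 1) :
    ∃ A : ℝ, 0 ≤ A ∧ ∀ h r : ℝ, 0 < h → 0 < r → r ≤ 1 → ∀ (u : Euc N → ℝ)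
      (z : Euc N × Euc N → ℝ), WeakSol s h u z → u 0 ≤ 2 * r + A * h / r := by
  obtain ⟨A, hA0, hA⟩ := apply_zero_le_of_weak (N := N) hN hs0 hs1
  refine ⟨A, hA0, fun h r hh hr hr1 u z hu => ?_⟩
  obtain ⟨B, z', hu'⟩ := hu.exists_calibratedSol hN hs0 hs1 hh
  exact hA h r hh hr hr1 u z hu'.lip hu.meas hu.bdd (hu.weak _ _ _ (isTest_hat hr hr1))

/-- The bound `u(0) ≤ 2 h^α` for small `h` and `α < 1/2`. -/
lemma WeakSol.apply_zero_le_rpow (hN : 1 ≤ N) (hs0 : 0 < s) (hs1 : s < 1) {α : ℝ} (hα : 0 < α)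
    (hα2 : α < 1 / 2) : ∃ h₁ : ℝ, 0 < h₁ ∧ ∀ h : ℝ, 0 < h → h ≤ h₁ → ∀ (u : Euc N → ℝ)
      (z : Euc N × Euc N → ℝ), WeakSol s h u z → u 0 ≤ 2 * h ^ α := by
  obtain ⟨A, hA0, hA⟩ := WeakSol.apply_zero_le (N := N) hN hs0 hs1
  have hlim : Tendsto (fun h : ℝ => 2 * A * h ^ (1 - 2 * α)) (𝓝 0) (𝓝 0) := by
    have : ContinuousAt (fun h : ℝ => 2 * A * h ^ (1 - 2 * α)) 0 :=
      (Real.continuousAt_rpow_const _ _ (Or.inr (by linarith))).const_mul _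
    have h2 := this.tendsto
    rwa [Real.zero_rpow (by linarith), mul_zero] at h2
  obtain ⟨ε, hε, hball⟩ := Metric.eventually_nhds_iff.1 (hlim.eventually_lt_const one_pos)
  refine ⟨min 1 (ε / 2), by positivity, fun h hh hh1 u z hu => ?_⟩
  have h1 : h ≤ 1 := hh1.trans (min_le_left _ _)
  have h2 : h < ε := by linarith [hh1.trans (min_le_right _ _)]
  -- With this radius `2r = h^α` and `A h / r = 2 A h^(1-2α) h^α`; the factor `2 A h^(1-2α)` is
  -- below `1` for small `h` because `α < 1/2`.
  have hr : 0 < h ^ α / 2 := by positivity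
  have hr1 : h ^ α / 2 ≤ 1 := by
    have := Real.rpow_le_one hh.le h1 hα.le
    linarith
  have h3 := hA h _ hh hr hr1 u z hu
  have h4 : 2 * A * h ^ (1 - 2 * α) < 1 := hball (by
    rw [Real.dist_eq, sub_zero, abs_of_pos hh]; exact h2)
  have h5 : A * h / (h ^ α / 2) = 2 * A * h ^ (1 - 2 * α) * h ^ α := by
    have e : h = h ^ (1 - 2 * α) * h ^ α * h ^ α := by
      rw [← Real.rpow_add hh, ← Real.rpow_add hh]
      conv_lhs => rw [← Real.rpow_one h]
      congr 1; ring
    have hne : h ^ α ≠ 0 := by positivity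
    rw [div_eq_iff hr.ne']
    nth_rewrite 1 [e]
    ring
  have h6 : 0 < h ^ α := by positivity
  rw [h5] at h3
  nlinarith

end weakSol

/-! ### The fractional curvature of balls -/

section curvature

variable {N : ℕ} {s : ℝ}

/-- The displacements `v` such that neither `x + v` nor `x - v` is in the open ball `B_{|x|}`. -/
def outerDisp (x : Euc N) : Set (Euc N) := {v | |2 * inner ℝ x v| ≤ ‖v‖ ^ 2}

/-- The fractional curvature of `B_{|x|}` at `x`, without the factor `c_s`. -/
noncomputable def curv (s : ℝ) (x : Euc N) : ℝ := ∫ v in outerDisp x, ker s v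

/-- The truncated fractional curvature integral of `B_{|x|}` at `x`. -/
noncomputable def curvTrunc (s ε : ℝ) (x : Euc N) : ℝ :=
  ∫ y, Real.sign (‖y‖ - ‖x‖) * kerTrunc s ε (x - y)

lemma measurableSet_outerDisp (x : Euc N) : MeasurableSet (outerDisp x) :=
  measurableSet_le (by fun_prop) (by fun_prop)

lemma measurable_sign : Measurable Real.sign := by
  unfold Real.sign
  exact Measurable.ite measurableSet_Iio measurable_const
    (Measurable.ite measurableSet_Ioi measurable_const measurable_const)

lemma abs_sign_le (t : ℝ) : |Real.sign t| ≤ 1 := by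
  rcases Real.sign_apply_eq t with h | h | h <;> simp [h]

lemma sign_norm_sub (x v : Euc N) :
    Real.sign (‖x - v‖ - ‖x‖) = Real.sign (‖v‖ ^ 2 - 2 * inner ℝ x v) := by
  have h1 := norm_sub_sq_real x v
  have h2 : (‖x - v‖ - ‖x‖) * (‖x - v‖ + ‖x‖) = ‖v‖ ^ 2 - 2 * inner ℝ x v := by
    have : (‖x - v‖ - ‖x‖) * (‖x - v‖ + ‖x‖) = ‖x - v‖ ^ 2 - ‖x‖ ^ 2 := by ring
    linarith
  have h3 : 0 ≤ ‖x - v‖ + ‖x‖ := by positivity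
  rcases h3.eq_or_lt with h0 | h0
  · have h4 := norm_nonneg x
    have h5 := norm_nonneg (x - v)
    rw [← h2, ← h0, mul_zero, show ‖x - v‖ - ‖x‖ = 0 by linarith]
  · rw [← h2]
    rcases lt_trichotomy (‖x - v‖ - ‖x‖) 0 with h | h | h
    · rw [Real.sign_of_neg h, Real.sign_of_neg (mul_neg_of_neg_of_pos h h0)]
    · rw [h, zero_mul]
    · rw [Real.sign_of_pos h, Real.sign_of_pos (mul_pos h h0)]

lemma integrable_sign_mul {K : Euc N → ℝ} (hK : Integrable K) (x : Euc N) :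
    Integrable (fun v => Real.sign (‖x - v‖ - ‖x‖) * K v) :=
  hK.bdd_mul (measurable_sign.comp (by fun_prop)).aestronglyMeasurable
    (ae_of_all _ fun v => abs_sign_le _)

/-- Averaging over `v` and `-v`: since `|x - v|² - |x|² = |v|² - 2⟨x,v⟩`, the two signs are both `1`
when `v` is in `outerDisp x` and cancel otherwise, up to two null spheres. The integrand becomes
nonnegative, so the principal value is a monotone limit. -/
lemma curvTrunc_eq (hN : 1 ≤ N) (hs0 : 0 < s) (hs1 : s < 1) {ε : ℝ} (hε : 0 < ε) (x : Euc N) :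
    curvTrunc s ε x = ∫ v in outerDisp x, kerTrunc s ε v := by
  have := euc_nontrivial hN
  have hK := integrable_kerTrunc (N := N) hN hs0 hs1 hε
  set f : Euc N → ℝ := fun v => Real.sign (‖x - v‖ - ‖x‖) * kerTrunc s ε v with hf
  have hfi : Integrable f := integrable_sign_mul hK x
  have e1 : curvTrunc s ε x = ∫ v, f v := by
    have := integral_sub_left_eq_self
      (fun y => Real.sign (‖y‖ - ‖x‖) * kerTrunc s ε (x - y)) volume x
    simp only [sub_sub_cancel] at this
    rw [curvTrunc, ← this]
  have e2 : ∫ v, f (-v) = ∫ v, f v := integral_neg_eq_self f volume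
  have e3 : ∫ v, f v = ∫ v, 1 / 2 * (f v + f (-v)) := by
    rw [integral_const_mul, integral_add hfi hfi.comp_neg, e2]; ring
  rw [e1, e3, ← integral_indicator (measurableSet_outerDisp x)]
  refine integral_congr_ae ?_
  have n1 : ∀ᵐ v, v ∉ Metric.sphere x ‖x‖ :=
    measure_eq_zero_iff_ae_notMem.1 (Measure.addHaar_sphere _ _ _)
  have n2 : ∀ᵐ v, v ∉ Metric.sphere (-x) ‖x‖ :=
    measure_eq_zero_iff_ae_notMem.1 (Measure.addHaar_sphere _ _ _)
  filter_upwards [n1, n2] with v h1 h2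
  rw [mem_sphere_iff_norm] at h1 h2
  have h1' : ‖x - v‖ - ‖x‖ ≠ 0 := by
    rw [norm_sub_rev]; exact sub_ne_zero.2 h1
  have h2' : ‖x - -v‖ - ‖x‖ ≠ 0 := by
    rw [sub_neg_eq_add, add_comm, ← sub_neg_eq_add]; exact sub_ne_zero.2 h2
  simp only [hf]
  rw [sign_norm_sub, sign_norm_sub, kerTrunc_neg, norm_neg, inner_neg_right]
  have h3 : ‖v‖ ^ 2 - 2 * inner ℝ x v ≠ 0 := by
    intro h
    have := sign_norm_sub x v
    rw [h, Real.sign_zero, Real.sign_eq_zero_iff] at this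
    exact h1' this
  have h4 : ‖v‖ ^ 2 - 2 * -inner ℝ x v ≠ 0 := by
    intro h
    have := sign_norm_sub x (-v)
    rw [norm_neg, inner_neg_right, h, Real.sign_zero, Real.sign_eq_zero_iff] at this
    exact h2' this
  have h5 : 0 ≤ ‖v‖ ^ 2 := by positivity
  set a := ‖v‖ ^ 2
  by_cases hD : v ∈ outerDisp x
  · rw [Set.indicator_of_mem hD]
    have hD' : |2 * inner ℝ x v| ≤ a := hD
    have h6 := abs_le.1 hD'
    rw [Real.sign_of_pos (lt_of_le_of_ne (by linarith [h6.2]) (Ne.symm h3)),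
      Real.sign_of_pos (lt_of_le_of_ne (by linarith [h6.1]) (Ne.symm h4))]
    ring
  · rw [Set.indicator_of_notMem hD]
    have h6 : a < |2 * inner ℝ x v| := not_le.1 hD
    rcases lt_abs.1 h6 with h | h
    · rw [Real.sign_of_neg (by linarith), Real.sign_of_pos (by linarith)]; ring
    · rw [Real.sign_of_pos (by linarith), Real.sign_of_neg (by linarith)]; ring

/-- The reflection exchanging `x` and `y` maps one domain of integration onto the other and
preserves the radial weight. -/
lemma setIntegral_outerDisp_congr {K : Euc N → ℝ} (hK : ∀ v w, ‖v‖ = ‖w‖ → K v = K w)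
    {x y : Euc N} (hxy : ‖x‖ = ‖y‖) :
    ∫ v in outerDisp x, K v = ∫ v in outerDisp y, K v := by
  set U := (ℝ ∙ (x - y))ᗮ.reflection with hU
  have hUx : U x = y := Submodule.reflection_sub hxy
  rw [← integral_indicator (measurableSet_outerDisp x),
    ← integral_indicator (measurableSet_outerDisp y),
    ← U.measurePreserving.integral_comp U.toHomeomorph.measurableEmbedding
      ((outerDisp y).indicator K)]
  congr 1; ext v
  have hm : U v ∈ outerDisp y ↔ v ∈ outerDisp x := by
    simp only [outerDisp, Set.mem_ofPred_eq]
    rw [← hUx, U.inner_map_map, U.norm_map]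
  by_cases h : v ∈ outerDisp x
  · rw [Set.indicator_of_mem h, Set.indicator_of_mem (hm.2 h)]
    exact hK _ _ (U.norm_map v).symm
  · rw [Set.indicator_of_notMem h, Set.indicator_of_notMem (fun h' => h (hm.1 h'))]

/-- The source of the monotonicity of the curvature: scaling `x` up enlarges `|⟨x,v⟩|` and leaves
`|v|²` unchanged. -/
lemma outerDisp_smul_subset {t : ℝ} (ht : 1 ≤ t) (x : Euc N) :
    outerDisp (t • x) ⊆ outerDisp x := by
  intro v hv
  simp only [outerDisp, Set.mem_ofPred_eq, real_inner_smul_left] at hv ⊢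
  rw [show 2 * (t * inner ℝ x v) = t * (2 * inner ℝ x v) by ring, abs_mul,
    abs_of_pos (by linarith)] at hv
  nlinarith [abs_nonneg (2 * inner ℝ x v)]

lemma setIntegral_outerDisp_anti {K : Euc N → ℝ} (hK : ∀ v w, ‖v‖ = ‖w‖ → K v = K w)
    (hK0 : ∀ v, 0 ≤ K v) {x y : Euc N} (hy : y ≠ 0) (hxy : ‖y‖ ≤ ‖x‖)
    (hi : IntegrableOn K (outerDisp y)) :
    ∫ v in outerDisp x, K v ≤ ∫ v in outerDisp y, K v := by
  have hy0 : 0 < ‖y‖ := norm_pos_iff.2 hy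
  have hx : ‖x‖ = ‖(‖x‖ / ‖y‖) • y‖ := by
    rw [norm_smul, Real.norm_of_nonneg (by positivity)]; field_simp
  rw [setIntegral_outerDisp_congr hK hx]
  exact setIntegral_mono_set hi (ae_of_all _ hK0)
    (outerDisp_smul_subset ((one_le_div hy0).2 hxy) y).eventuallyLE

lemma ker_radial (v w : Euc N) (h : ‖v‖ = ‖w‖) : ker s v = ker s w := by
  unfold ker; rw [h]

lemma kerTrunc_radial (ε : ℝ) (v w : Euc N) (h : ‖v‖ = ‖w‖) :
    kerTrunc s ε v = kerTrunc s ε w := by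
  simp [kerTrunc, Set.indicator, h, ker_radial v w h]

lemma curvTrunc_anti (hN : 1 ≤ N) (hs0 : 0 < s) (hs1 : s < 1) {ε : ℝ} (hε : 0 < ε)
    {x y : Euc N} (hy : y ≠ 0) (hxy : ‖y‖ ≤ ‖x‖) : curvTrunc s ε x ≤ curvTrunc s ε y := by
  rw [curvTrunc_eq hN hs0 hs1 hε, curvTrunc_eq hN hs0 hs1 hε]
  exact setIntegral_outerDisp_anti (kerTrunc_radial ε) (kerTrunc_nonneg ε) hy hxy
    (integrable_kerTrunc hN hs0 hs1 hε).integrableOn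

/-- The field `sign (|x| - |y|)`. -/
noncomputable def radialField (p : Euc N × Euc N) : ℝ := Real.sign (‖p.1‖ - ‖p.2‖)

lemma measurable_radialField : Measurable (radialField : Euc N × Euc N → ℝ) :=
  measurable_sign.comp (by fun_prop)

/-- Truncated nonlocal integration by parts for the radial field. -/
lemma integral_mul_curvTrunc (hN : 1 ≤ N) (hs0 : 0 < s) (hs1 : s < 1) {ε : ℝ} (hε : 0 < ε)
    {ψ : Euc N → ℝ} (hψ : Integrable ψ) :
    ∫ x, ψ x * curvTrunc s ε x =
      -(1 / 2 * ∫ p, radialField p * ((ψ p.1 - ψ p.2) * kerTrunc s ε (p.1 - p.2))) := by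
  have h := integral_mul_integral_kernel hψ (integrable_kerTrunc hN hs0 hs1 hε)
    (kerTrunc_neg ε) measurable_radialField.aestronglyMeasurable (fun p => abs_sign_le _)
    (fun x y => by
      simp only [radialField]; rw [← Real.sign_neg]; ring_nf)
  rw [← h, ← integral_neg]
  refine integral_congr_ae (ae_of_all _ fun x => ?_)
  simp only [curvTrunc, radialField]
  rw [← mul_neg, ← integral_neg]
  congr 2; ext y
  rw [← neg_sub ‖x‖ ‖y‖, Real.sign_neg]; ring

lemma abs_radialField_mul_le {ε : ℝ} (ψ : Euc N → ℝ) (p : Euc N × Euc N) :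
    |radialField p * ((ψ p.1 - ψ p.2) * kerTrunc s ε (p.1 - p.2))| ≤ |dq s ψ p| := by
  rw [dq_eq, abs_mul, abs_mul, abs_mul, abs_of_nonneg (kerTrunc_nonneg _ _),
    abs_of_nonneg (ker_nonneg _)]
  refine (mul_le_of_le_one_left (mul_nonneg (abs_nonneg _) (kerTrunc_nonneg _ _))
    (abs_sign_le _)).trans ?_
  exact mul_le_mul_of_nonneg_left (kerTrunc_le _ _) (abs_nonneg _)

lemma integrable_mul_curvTrunc (hN : 1 ≤ N) (hs0 : 0 < s) (hs1 : s < 1) {ε : ℝ} (hε : 0 < ε)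
    {ψ : Euc N → ℝ} (hψ : Integrable ψ) : Integrable (fun x => ψ x * curvTrunc s ε x) := by
  have hK := integrable_kerTrunc (N := N) hN hs0 hs1 hε
  have h1 : Integrable (fun p : Euc N × Euc N =>
      Real.sign (‖p.2‖ - ‖p.1‖) * (ψ p.1 * kerTrunc s ε (p.1 - p.2))) :=
    (integrable_prod_mul_sub' hψ hK (kerTrunc_neg ε)).bdd_mul
      (measurable_sign.comp (by fun_prop)).aestronglyMeasurable (ae_of_all _ fun p => abs_sign_le _)
  rw [Measure.volume_eq_prod] at h1
  refine h1.integral_prod_left.congr (ae_of_all _ fun x => ?_)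
  simp only [curvTrunc]
  rw [← integral_const_mul]
  congr 1; ext y; ring

/-- No local expansion of the sphere is needed. By monotonicity the truncated curvature at `x` is at
most that at every nonzero point of the ball of radius `min 1 ‖x‖`, hence at most its average
against a hat function, which integration by parts bounds independently of `ε`. -/
lemma exists_curvTrunc_le (hN : 1 ≤ N) (hs0 : 0 < s) (hs1 : s < 1) {x : Euc N} (hx : x ≠ 0) :
    ∃ B, ∀ ε, 0 < ε → curvTrunc s ε x ≤ B := by
  have := euc_nontrivial hN
  set r := min 1 ‖x‖ with hr
  have hr0 : 0 < r := lt_min one_pos (norm_pos_iff.2 hx)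
  have ht := isTest_hat (N := N) hr0 (min_le_left _ _)
  have hψ0 : ∀ y : Euc N, 0 ≤ hat r y := fun y => le_max_left _ _
  have hI : 0 < ∫ y : Euc N, hat r y :=
    (ht.continuous hN).integral_pos_of_hasCompactSupport_nonneg_nonzero ht.hasCompactSupport hψ0
      (x := 0) (by simp [hat])
  refine ⟨(1 / 2 * ∫ p, |dq s (hat r : Euc N → ℝ) p|) / ∫ y : Euc N, hat r y, fun ε hε => ?_⟩
  rw [le_div_iff₀ hI]
  have h1 : curvTrunc s ε x * ∫ y : Euc N, hat r y ≤ ∫ y : Euc N, hat r y * curvTrunc s ε y := by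
    rw [← integral_const_mul]
    refine integral_mono_ae ((ht.integrable hN).const_mul _)
      (integrable_mul_curvTrunc hN hs0 hs1 hε (ht.integrable hN)) ?_
    have : ∀ᵐ y : Euc N, y ∉ ({0} : Set (Euc N)) :=
      measure_eq_zero_iff_ae_notMem.1 (measure_singleton _)
    filter_upwards [this] with y hy
    rw [mul_comm]
    by_cases hyr : r < ‖y‖
    · rw [ht.supp y hyr]; simp
    · refine mul_le_mul_of_nonneg_left (curvTrunc_anti hN hs0 hs1 hε (by simpa using hy) ?_) (hψ0 y)
      exact (not_lt.1 hyr).trans (min_le_right _ _)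
  refine h1.trans ?_
  rw [integral_mul_curvTrunc hN hs0 hs1 hε (ht.integrable hN), ← mul_neg]
  refine mul_le_mul_of_nonneg_left ((neg_le_abs _).trans ?_) (by norm_num)
  rw [← Real.norm_eq_abs]
  exact norm_integral_le_of_norm_le (ht.integrable_dq hN hs0 hs1).abs
    (ae_of_all _ fun p => abs_radialField_mul_le _ p)

lemma setIntegral_kerTrunc (ε : ℝ) (S : Set (Euc N)) :
    ∫ v in S, kerTrunc s ε v = ∫ v in {v : Euc N | ε ≤ ‖v‖}, ker s v ∂(volume.restrict S) :=
  integral_indicator (measurableSet_le measurable_const measurable_norm)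

lemma aecover_norm_ge (hN : 1 ≤ N) (S : Set (Euc N)) :
    AECover (volume.restrict S) (𝓝[>] (0 : ℝ)) fun ε => {v : Euc N | ε ≤ ‖v‖} := by
  have := euc_nontrivial hN
  constructor
  · have : ∀ᵐ y : Euc N, y ∉ ({0} : Set (Euc N)) :=
      measure_eq_zero_iff_ae_notMem.1 (measure_singleton _)
    filter_upwards [ae_restrict_of_ae this] with v hv
    have hv0 : 0 < ‖v‖ := norm_pos_iff.2 (by simpa using hv)
    filter_upwards [Ioo_mem_nhdsGT hv0] with ε hε
    exact hε.2.le
  · exact fun ε => measurableSet_le measurable_const measurable_norm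

lemma integrableOn_ker_outerDisp (hN : 1 ≤ N) (hs0 : 0 < s) (hs1 : s < 1) {x : Euc N}
    (hx : x ≠ 0) : IntegrableOn (ker s) (outerDisp x) := by
  obtain ⟨B, hB⟩ := exists_curvTrunc_le (s := s) hN hs0 hs1 hx
  have hseq : Tendsto (fun n : ℕ => 1 / ((n : ℝ) + 1)) atTop (𝓝[>] 0) :=
    tendsto_nhdsWithin_iff.2 ⟨tendsto_one_div_add_atTop_nhds_zero_nat,
      Eventually.of_forall fun n => by
        have : 0 < 1 / ((n : ℝ) + 1) := by positivity
        exact this⟩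
  have hcov : AECover (volume.restrict (outerDisp x)) atTop
      fun n : ℕ => {v : Euc N | 1 / ((n : ℝ) + 1) ≤ ‖v‖} := by
    have h := aecover_norm_ge hN (outerDisp x)
    exact ⟨h.ae_eventually_mem.mono fun v hv => hseq.eventually hv, fun n => h.measurableSet _⟩
  refine hcov.integrable_of_integral_norm_bounded B (fun n => ?_) (Eventually.of_forall fun n => ?_)
  · have h1 : 0 < 1 / ((n : ℝ) + 1) := by positivity
    have h2 := (integrable_kerTrunc (N := N) hN hs0 hs1 h1).integrableOn (s := outerDisp x)
    exact (integrable_indicator_iff (hcov.measurableSet n)).1 h2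
  · have h1 : 0 < 1 / ((n : ℝ) + 1) := by positivity
    have h2 := hB _ h1
    rw [curvTrunc_eq hN hs0 hs1 h1, setIntegral_kerTrunc] at h2
    refine le_trans (le_of_eq ?_) h2
    exact integral_congr_ae (ae_of_all _ fun v => Real.norm_of_nonneg (ker_nonneg v))

lemma tendsto_curvTrunc (hN : 1 ≤ N) (hs0 : 0 < s) (hs1 : s < 1) {x : Euc N} (hx : x ≠ 0) :
    Tendsto (fun ε => curvTrunc s ε x) (𝓝[>] 0) (𝓝 (curv s x)) := by
  have h := (aecover_norm_ge hN (outerDisp x)).integral_tendsto_of_countably_generated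
    (integrableOn_ker_outerDisp hN hs0 hs1 hx)
  refine h.congr' ?_
  filter_upwards [self_mem_nhdsWithin] with ε hε
  rw [curvTrunc_eq hN hs0 hs1 hε, setIntegral_kerTrunc]

lemma curvTrunc_le_curv (hN : 1 ≤ N) (hs0 : 0 < s) (hs1 : s < 1) {ε : ℝ} (hε : 0 < ε) {x : Euc N}
    (hx : x ≠ 0) : curvTrunc s ε x ≤ curv s x := by
  rw [curvTrunc_eq hN hs0 hs1 hε, curv]
  exact setIntegral_mono (integrable_kerTrunc hN hs0 hs1 hε).integrableOn
    (integrableOn_ker_outerDisp hN hs0 hs1 hx) (kerTrunc_le ε)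

lemma curv_congr {x y : Euc N} (hxy : ‖x‖ = ‖y‖) : curv s x = curv s y :=
  setIntegral_outerDisp_congr ker_radial hxy

lemma curv_anti (hN : 1 ≤ N) (hs0 : 0 < s) (hs1 : s < 1) {x y : Euc N} (hy : y ≠ 0)
    (hxy : ‖y‖ ≤ ‖x‖) : curv s x ≤ curv s y :=
  setIntegral_outerDisp_anti ker_radial ker_nonneg hy hxy
    (integrableOn_ker_outerDisp hN hs0 hs1 hy)

/-- Change of variables `v ↦ t v`. Together with positivity, this homogeneity of degree `-s` makes
the decrease in the radius strict. -/
lemma curv_smul {t : ℝ} (ht : 0 < t) (x : Euc N) : curv s (t • x) = t ^ (-s) * curv s x := by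
  have hcomp := Measure.integral_comp_smul (volume : Measure (Euc N))
    ((outerDisp (t • x)).indicator (ker s)) t
  have e1 : ∀ v : Euc N, (outerDisp (t • x)).indicator (ker s) (t • v) =
      t ^ (-((N : ℝ) + s)) * (outerDisp x).indicator (ker s) v := by
    intro v
    have hm : t • v ∈ outerDisp (t • x) ↔ v ∈ outerDisp x := by
      simp only [outerDisp, Set.mem_ofPred_eq, real_inner_smul_left, real_inner_smul_right,
        norm_smul, Real.norm_of_nonneg ht.le]
      rw [show 2 * (t * (t * inner ℝ x v)) = t ^ 2 * (2 * inner ℝ x v) by ring, abs_mul,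
        abs_of_pos (by positivity), mul_pow]
      exact mul_le_mul_iff_right₀ (by positivity)
    by_cases hv : v ∈ outerDisp x
    · rw [Set.indicator_of_mem hv, Set.indicator_of_mem (hm.2 hv), ker, ker, norm_smul,
        Real.norm_of_nonneg ht.le, Real.mul_rpow ht.le (norm_nonneg _), Real.rpow_neg ht.le]
      field_simp
    · rw [Set.indicator_of_notMem hv, Set.indicator_of_notMem (fun h => hv (hm.1 h)), mul_zero]
  simp_rw [e1] at hcomp
  rw [integral_const_mul, integral_indicator (measurableSet_outerDisp _),
    integral_indicator (measurableSet_outerDisp _), smul_eq_mul, abs_of_pos (by positivity),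
    finrank_euclideanSpace_fin] at hcomp
  unfold curv
  have hN : 0 < t ^ N := by positivity
  have h2 : ∫ v in outerDisp (t • x), ker s v =
      t ^ N * (t ^ (-((N : ℝ) + s)) * ∫ v in outerDisp x, ker s v) := by
    rw [hcomp]; field_simp
  rw [h2, ← mul_assoc, ← Real.rpow_natCast t N, ← Real.rpow_add ht]
  congr 2; ring

lemma curv_pos (hN : 1 ≤ N) (hs0 : 0 < s) (hs1 : s < 1) {x : Euc N} (hx : x ≠ 0) :
    0 < curv s x := by
  have := euc_nontrivial hN
  rw [curv, setIntegral_pos_iff_support_of_nonneg_ae (ae_of_all _ ker_nonneg)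
    (integrableOn_ker_outerDisp hN hs0 hs1 hx)]
  have hopen : IsOpen {v : Euc N | 2 * ‖x‖ < ‖v‖} := isOpen_lt continuous_const continuous_norm
  obtain ⟨y, hy⟩ := NormedSpace.exists_lt_norm ℝ (Euc N) (2 * ‖x‖)
  refine (hopen.measure_pos volume ⟨y, hy⟩).trans_le (measure_mono fun v hv => ⟨?_, ?_⟩)
  · have hv' : 2 * ‖x‖ < ‖v‖ := hv
    have : 0 < ‖v‖ := (by positivity : (0 : ℝ) ≤ 2 * ‖x‖).trans_lt hv'
    rw [Function.mem_support, ker]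
    positivity
  · have hv' : 2 * ‖x‖ < ‖v‖ := hv
    have h1 := abs_real_inner_le_norm x v
    have h2 : |2 * inner ℝ x v| ≤ ‖v‖ ^ 2 := by
      rw [abs_mul, abs_of_pos two_pos]
      nlinarith [norm_nonneg x, norm_nonneg v]
    exact h2

lemma hasCurvature_ball (hN : 1 ≤ N) (hs0 : 0 < s) (hs1 : s < 1) {x : Euc N} (hx : x ≠ 0) :
    HasCurvature s (Metric.ball (0 : Euc N) ‖x‖) x (cs N s * curv s x) := by
  have := euc_nontrivial hN
  unfold HasCurvature
  refine ((tendsto_curvTrunc hN hs0 hs1 hx).const_mul (cs N s)).congr' ?_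
  filter_upwards [self_mem_nhdsWithin] with ε hε
  congr 1
  rw [curvTrunc, ← integral_indicator Metric.isOpen_ball.measurableSet.compl]
  refine integral_congr_ae ?_
  have n1 : ∀ᵐ v, v ∉ Metric.sphere (0 : Euc N) ‖x‖ :=
    measure_eq_zero_iff_ae_notMem.1 (Measure.addHaar_sphere _ _ _)
  filter_upwards [n1] with y hy
  have hy' : ‖y‖ ≠ ‖x‖ := by simpa using hy
  have hmem : y ∈ (Metric.ball x ε)ᶜ ↔ ε ≤ ‖x - y‖ := by
    rw [Set.mem_compl_iff, mem_ball_iff_norm, not_lt, norm_sub_rev]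
  by_cases h : ε ≤ ‖x - y‖
  · rw [Set.indicator_of_mem (hmem.2 h), kerTrunc, Set.indicator_of_mem (by exact h), ker]
    rcases lt_or_gt_of_ne hy' with h2 | h2
    · have h3 : y ∈ Metric.ball (0 : Euc N) ‖x‖ := by simpa using h2
      rw [Real.sign_of_neg (by linarith), Set.indicator_of_mem h3,
        Set.indicator_of_notMem (by simpa using h2)]
      ring
    · have h3 : y ∉ Metric.ball (0 : Euc N) ‖x‖ := by simpa using h2.le
      rw [Real.sign_of_pos (by linarith), Set.indicator_of_notMem h3,
        Set.indicator_of_mem h3]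
      ring
  · rw [Set.indicator_of_notMem (fun h' => h (hmem.1 h')), kerTrunc,
      Set.indicator_of_notMem (by exact h), mul_zero]

/-- A lower bound for the divergence of the radial field, tested against nonnegative functions
vanishing near the origin. -/
lemma neg_curv_mul_integral_le (hN : 1 ≤ N) (hs0 : 0 < s) (hs1 : s < 1) {ψ : Euc N → ℝ} {C ρ : ℝ}
    (ht : IsTest C ρ ψ) (hψ : ∀ x, 0 ≤ ψ x) {e : Euc N} (he : e ≠ 0)
    (hsupp : ∀ x, ‖x‖ < ‖e‖ → ψ x = 0) :
    - (curv s e * ∫ x, ψ x) ≤ 1 / 2 * ∫ p, radialField p * dq s ψ p := by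
  have hseq : Tendsto (fun n : ℕ => 1 / ((n : ℝ) + 1)) atTop (𝓝 0) :=
    tendsto_one_div_add_atTop_nhds_zero_nat
  have hlim : Tendsto (fun n : ℕ => ∫ p : Euc N × Euc N, radialField p *
      ((ψ p.1 - ψ p.2) * kerTrunc s (1 / ((n : ℝ) + 1)) (p.1 - p.2))) atTop
      (𝓝 (∫ p, radialField p * dq s ψ p)) := by
    refine tendsto_integral_of_dominated_convergence (fun p => |dq s ψ p|) (fun n => ?_)
      (ht.integrable_dq hN hs0 hs1).abs
      (fun n => ae_of_all _ fun p => abs_radialField_mul_le _ p) ?_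
    · exact (measurable_radialField.mul ((ht.continuous_diff hN).measurable.mul
        ((measurable_kerTrunc _).comp (by fun_prop)))).aestronglyMeasurable
    · filter_upwards [ae_fst_ne_snd hN] with p hp
      have hp0 : 0 < ‖p.1 - p.2‖ := norm_pos_iff.2 (sub_ne_zero.2 hp)
      rw [dq_eq]
      refine tendsto_const_nhds.congr' ?_
      filter_upwards [hseq.eventually_le_const hp0] with n hn
      rw [kerTrunc, Set.indicator_of_mem (by exact hn)]
  refine ge_of_tendsto' (hlim.const_mul (1 / 2)) fun n => ?_
  have hε : 0 < 1 / ((n : ℝ) + 1) := by positivity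
  -- After truncation the right-hand side is `-∫ ψ · curvTrunc`, and wherever `‖x‖ ≥ ‖e‖` the
  -- truncated curvature is at most `curv s x ≤ curv s e`.
  rw [← neg_neg (1 / 2 * _), ← integral_mul_curvTrunc hN hs0 hs1 hε (ht.integrable hN)]
  refine neg_le_neg ?_
  rw [← integral_const_mul]
  refine integral_mono (integrable_mul_curvTrunc hN hs0 hs1 hε (ht.integrable hN))
    ((ht.integrable hN).const_mul _) fun x => ?_
  simp only
  by_cases hx : ‖x‖ < ‖e‖
  · rw [hsupp x hx]; simp
  · have hx' : ‖e‖ ≤ ‖x‖ := not_lt.1 hx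
    have hx0 : x ≠ 0 := norm_pos_iff.1 ((norm_pos_iff.2 he).trans_le hx')
    rw [mul_comm]
    exact mul_le_mul_of_nonneg_right ((curvTrunc_le_curv hN hs0 hs1 hε hx0).trans
      (curv_anti hN hs0 hs1 he hx')) (hψ x)

end curvature

/-! ### Supersolutions built from the norm -/

section upper

variable {N : ℕ} {s h : ℝ}

lemma radialField_mul_max (a : ℝ) (b : ℝ) (p : Euc N × Euc N) :
    radialField p * ((b + max ‖p.1‖ a) - (b + max ‖p.2‖ a)) =
      |(b + max ‖p.1‖ a) - (b + max ‖p.2‖ a)| := by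
  unfold radialField
  rw [add_sub_add_left_eq_sub]
  rcases lt_trichotomy ‖p.1‖ ‖p.2‖ with h | h | h
  · rw [Real.sign_of_neg (by linarith), abs_of_nonpos (by
      linarith [max_le_max_right a h.le])]; ring
  · rw [h]; simp
  · rw [Real.sign_of_pos (by linarith), abs_of_nonneg (by
      linarith [max_le_max_right a h.le])]; ring

/-- Upper bound for solutions by the supersolution `b + max |x| a`. -/
lemma WeakSol.le_max (hN : 1 ≤ N) (hs0 : 0 < s) (hs1 : s < 1) (hh : 0 < h) {u : Euc N → ℝ}
    {z : Euc N × Euc N → ℝ} (hu : WeakSol s h u z) {a b d : ℝ} {e : Euc N} (he : e ≠ 0)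
    (hd : ∀ x, u x ≤ ‖x‖ + d) (hea : ‖e‖ + d ≤ a) (hb : h * (cs N s * curv s e) ≤ b)
    (x : Euc N) : u x ≤ b + max ‖x‖ a := by
  have hc := cs_pos (N := N) hs1
  have hcurv := curv_pos hN hs0 hs1 he
  have hb0 : 0 < b := lt_of_lt_of_le (by positivity) hb
  set w : Euc N → ℝ := fun x => b + max ‖x‖ a with hw
  have hwl : LipschitzWith 1 w := LipschitzWith.of_le_add fun x y => by
    have h1 := norm_sub_norm_le x y
    rw [dist_eq_norm]
    have h2 := norm_nonneg (x - y)
    simp only [hw]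
    have : max ‖x‖ a ≤ max ‖y‖ a + ‖x - y‖ :=
      max_le (by linarith [le_max_left ‖y‖ a]) (by linarith [le_max_right ‖y‖ a])
    linarith
  have hwn : ∀ x, ‖x‖ ≤ w x := fun x => by
    simp only [hw]; linarith [le_max_left ‖x‖ a]
  have hwm : w ∈ LPlus N := mem_LPlus_of_norm_le hwl hwn
  have hucont := continuous_of_mem_LPlus hu.mem
  have key : ∀ M, min (u x) M ≤ w x := by
    intro M
    obtain ⟨C, ρ, ht⟩ := isTest_trunc hu.mem hwm M
    set ψ : Euc N → ℝ := fun x => max 0 (min (u x) M - w x) with hψ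
    have hψ0 : ∀ x, 0 ≤ ψ x := fun x => le_max_left _ _
    have h1 : h * (cs N s / 2 * ∫ p, radialField p * dq s ψ p) + ∫ x, u x * ψ x ≤
        ∫ x, ‖x‖ * ψ x := hu.le_of_aligned hN hs0 hs1 hh (w := w)
      measurable_radialField.aestronglyMeasurable
      (ae_of_all _ fun p => abs_sign_le _) (ae_of_all _ fun p => radialField_mul_max a b p) ht
    -- For `‖y‖ < ‖e‖` one has `u y ≤ ‖y‖ + d < a`, so the test function vanishes near the origin,
    -- where the curvature of small balls blows up.
    have h2 := neg_curv_mul_integral_le hN hs0 hs1 ht hψ0 he (fun y hy => by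
      refine max_eq_left ?_
      have h3 := min_le_left (u y) M
      have h4 := hd y
      have h5 := le_max_right ‖y‖ a
      simp only [hw]
      linarith)
    have h3 := mul_le_mul_of_nonneg_left h2 (by positivity : 0 ≤ h * cs N s)
    have h4 : ∫ x, (u x - ‖x‖ - h * cs N s * curv s e) * ψ x ≤ 0 := by
      simp_rw [sub_mul]
      have i1 := ht.integrable_mul hN hucont
      have i2 := ht.integrable_mul hN (f := fun x : Euc N => ‖x‖) continuous_norm
      have i3 := (ht.integrable hN).const_mul (h * cs N s * curv s e)
      have i12 : Integrable (fun x => u x * ψ x - ‖x‖ * ψ x) := i1.sub i2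
      rw [integral_sub i12 i3, integral_sub i1 i2, integral_const_mul]
      linarith
    -- Where the test function is positive, `u` exceeds `b + ‖y‖`, and `b` dominates the curvature
    -- term, so the weight is positive.
    have h5 := trunc_eq_zero_of_integral_nonpos hN ht
      (f := fun x => u x - ‖x‖ - h * cs N s * curv s e) (by fun_prop) (fun y hy => ?_) hψ0 h4 x
    · have := le_max_right 0 (min (u x) M - w x)
      simp only [hψ] at h5
      linarith
    · simp only [hψ, lt_max_iff, lt_irrefl, false_or] at hy
      have h6 := min_le_left (u y) M
      have h7 := le_max_left ‖y‖ a
      simp only [hw] at hy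
      nlinarith
  simpa using key (u x)

end upper

/-! ### Finiteness of the energy -/

section energy

variable {N : ℕ} {s h R : ℝ}

lemma perimeter_congr {F G : Set (Euc N)} (hFG : F =ᵐ[volume] G) :
    perimeter s F = perimeter s G := by
  unfold perimeter
  rw [Measure.restrict_congr_set hFG, Measure.restrict_congr_set hFG.compl]

lemma ballEnergy_congr {F G : Set (Euc N)} (hFG : F =ᵐ[volume] G) :
    ballEnergy s h R F = ballEnergy s h R G := by
  unfold ballEnergy extIntegral
  rw [perimeter_congr hFG, Measure.restrict_congr_set hFG]

lemma lintegral_neg_part_ne_top (F : Set (Euc N)) :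
    ∫⁻ x in F, ENNReal.ofReal (-(‖x‖ - R)) ≠ ⊤ := by
  refine ne_top_of_le_ne_top (b := ENNReal.ofReal R * volume (Metric.closedBall (0 : Euc N) R))
    (ENNReal.mul_ne_top ENNReal.ofReal_ne_top measure_closedBall_lt_top.ne) ?_
  calc ∫⁻ x in F, ENNReal.ofReal (-(‖x‖ - R))
      ≤ ∫⁻ x, ENNReal.ofReal (-(‖x‖ - R)) := setLIntegral_le_lintegral _ _
    _ ≤ ∫⁻ x, (Metric.closedBall (0 : Euc N) R).indicator (fun _ => ENNReal.ofReal R) x := by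
        refine lintegral_mono fun x => ?_
        simp only
        by_cases hx : x ∈ Metric.closedBall (0 : Euc N) R
        · rw [Set.indicator_of_mem hx]
          exact ENNReal.ofReal_le_ofReal (by linarith [norm_nonneg x])
        · rw [Set.indicator_of_notMem hx, ENNReal.ofReal_of_nonpos]
          have : R < ‖x‖ := by simpa using hx
          linarith
    _ = _ := by rw [lintegral_indicator_const measurableSet_closedBall]

/-- Outside the ball of radius `R + 1` the integrand is at least `1`. -/
lemma volume_ne_top_of_lintegral {F : Set (Euc N)} (hF : MeasurableSet F)
    (hi : ∫⁻ x in F, ENNReal.ofReal (‖x‖ - R) ≠ ⊤) : volume F ≠ ⊤ := by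
  have h1 : volume (F \ Metric.closedBall (0 : Euc N) (R + 1)) ≤
      ∫⁻ x in F, ENNReal.ofReal (‖x‖ - R) := by
    rw [← setLIntegral_one]
    refine (setLIntegral_mono' (hF.diff measurableSet_closedBall) fun x hx => ?_).trans
      (lintegral_mono_set Set.sdiff_subset)
    have h2 : R + 1 < ‖x‖ := by simpa using hx.2
    rw [← ENNReal.ofReal_one]
    exact ENNReal.ofReal_le_ofReal (by linarith)
  have h2 : volume F ≤ volume (F \ Metric.closedBall (0 : Euc N) (R + 1)) +
      volume (Metric.closedBall (0 : Euc N) (R + 1)) := by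
    refine (measure_mono ?_).trans (measure_union_le _ _)
    intro x hx
    by_cases hx' : x ∈ Metric.closedBall (0 : Euc N) (R + 1)
    · exact Or.inr hx'
    · exact Or.inl ⟨hx, hx'⟩
  exact ne_top_of_le_ne_top (ENNReal.add_ne_top.2
    ⟨ne_top_of_le_ne_top hi h1, measure_closedBall_lt_top.ne⟩) h2

lemma ballEnergy_eq_coe {F : Set (Euc N)} (hP : perimeter s F ≠ ⊤)
    (hi : IntegrableOn (fun x => ‖x‖ - R) F) :
    ballEnergy s h R F =
      (((perimeter s F).toReal + 1 / h * ∫ x in F, (‖x‖ - R) : ℝ) : EReal) := by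
  have h1 : ∫⁻ x in F, ENNReal.ofReal (‖x‖ - R) ≠ ⊤ := by
    refine ne_top_of_le_ne_top hi.2.ne (lintegral_mono fun x => ?_)
    exact Real.ofReal_le_enorm _
  have h2 := lintegral_neg_part_ne_top (R := R) F
  have h3 := integral_eq_lintegral_pos_part_sub_lintegral_neg_part hi
  unfold ballEnergy extIntegral
  rw [← EReal.coe_ennreal_toReal hP, ← EReal.coe_ennreal_toReal h1, ← EReal.coe_ennreal_toReal h2,
    h3]
  norm_cast

/-- The negative part of the volume term is always finite, so either the energy is infinite or all
its terms are finite and real arithmetic applies. -/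
lemma ballEnergy_eq_top_or (hh : 0 < h) {F : Set (Euc N)} (hF : MeasurableSet F) :
    ballEnergy s h R F = ⊤ ∨
      (perimeter s F ≠ ⊤ ∧ volume F ≠ ⊤ ∧ IntegrableOn (fun x => ‖x‖ - R) F) := by
  have h2 := lintegral_neg_part_ne_top (R := R) F
  have hh' : 0 < 1 / h := by positivity
  have hm : Measurable fun x : Euc N => ‖x‖ - R := by fun_prop
  by_cases h1 : ∫⁻ x in F, ENNReal.ofReal (‖x‖ - R) = ⊤
  · left
    unfold ballEnergy extIntegral
    rw [h1, ← EReal.coe_ennreal_toReal h2, EReal.coe_ennreal_top, EReal.top_sub_coe,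
      EReal.coe_mul_top_of_pos hh', EReal.add_top_of_ne_bot (EReal.coe_ennreal_ne_bot _)]
  · have hi : IntegrableOn (fun x => ‖x‖ - R) F := by
      refine ⟨hm.aestronglyMeasurable, ?_⟩
      have : ∀ x : Euc N, ‖‖x‖ - R‖ₑ = ENNReal.ofReal (‖x‖ - R) + ENNReal.ofReal (-(‖x‖ - R)) := by
        intro x
        rw [Real.enorm_eq_ofReal_abs]
        rcases le_total 0 (‖x‖ - R) with h | h
        · rw [abs_of_nonneg h, ENNReal.ofReal_of_nonpos (neg_nonpos.2 h), add_zero]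
        · rw [abs_of_nonpos h, ENNReal.ofReal_of_nonpos h, zero_add]
      rw [HasFiniteIntegral]
      simp_rw [this]
      rw [lintegral_add_left hm.ennreal_ofReal]
      exact ENNReal.add_lt_top.2 ⟨lt_top_iff_ne_top.2 h1, lt_top_iff_ne_top.2 h2⟩
    by_cases hP : perimeter s F = ⊤
    · left
      have h3 : extIntegral F (fun x => ‖x‖ - R) =
          (((∫⁻ x in F, ENNReal.ofReal (‖x‖ - R)).toReal -
            (∫⁻ x in F, ENNReal.ofReal (-(‖x‖ - R))).toReal : ℝ) : EReal) := by
        unfold extIntegral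
        rw [EReal.coe_sub, EReal.coe_ennreal_toReal h1, EReal.coe_ennreal_toReal h2]
      unfold ballEnergy
      rw [hP, h3, EReal.coe_ennreal_top, ← EReal.coe_mul, EReal.top_add_coe]
    · exact Or.inr ⟨hP, volume_ne_top_of_lintegral hF h1, hi⟩

end energy

/-! ### Sublevel sets as maximal minimizers -/

section maximal

variable {N : ℕ} {s h R B : ℝ} {u : Euc N → ℝ} {z : Euc N × Euc N → ℝ}

/-- Lipschitz approximations of the indicator function of `{u ≤ R}`. -/
noncomputable def ramp (u : Euc N → ℝ) (R : ℝ) (j : ℕ) (x : Euc N) : ℝ :=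
  max 0 (min (1 + ((j : ℝ) + 1) * (R - u x)) 1)

lemma ramp_nonneg (j : ℕ) (x : Euc N) : 0 ≤ ramp u R j x := le_max_left _ _

lemma ramp_le_one (j : ℕ) (x : Euc N) : ramp u R j x ≤ 1 :=
  max_le zero_le_one (min_le_right _ _)

lemma ramp_of_le {j : ℕ} {x : Euc N} (hx : u x ≤ R) : ramp u R j x = 1 := by
  unfold ramp
  have : 0 ≤ ((j : ℝ) + 1) * (R - u x) := mul_nonneg (by positivity) (by linarith)
  rw [min_eq_right (by linarith), max_eq_right zero_le_one]

lemma ramp_of_ge {j : ℕ} {x : Euc N} (hx : 1 ≤ ((j : ℝ) + 1) * (u x - R)) :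
    ramp u R j x = 0 := by
  unfold ramp
  exact max_eq_left ((min_le_left _ _).trans (by nlinarith))

lemma tendsto_ramp (x : Euc N) :
    Tendsto (fun j => ramp u R j x) atTop (𝓝 ({y | u y ≤ R}.indicator 1 x)) := by
  by_cases hx : u x ≤ R
  · rw [Set.indicator_of_mem (by exact hx)]
    simp_rw [ramp_of_le hx]
    exact tendsto_const_nhds
  · rw [Set.indicator_of_notMem (by exact hx)]
    have hpos : 0 < u x - R := by linarith [not_le.1 hx]
    refine tendsto_const_nhds.congr' ?_
    obtain ⟨M, hM⟩ := exists_nat_gt (1 / (u x - R))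
    filter_upwards [eventually_ge_atTop M] with j hj
    refine (ramp_of_ge ?_).symm
    rw [div_lt_iff₀ hpos] at hM
    have : (M : ℝ) ≤ j := by exact_mod_cast hj
    nlinarith

lemma exists_isTest_ramp (hu : u ∈ LPlus N) (R : ℝ) (j : ℕ) :
    ∃ C ρ, IsTest C ρ (ramp u R j) := by
  obtain ⟨⟨K, hK⟩, ht⟩ := hu
  have h1 : LipschitzWith (((j : NNReal) + 1) * K) (fun x => 1 + ((j : ℝ) + 1) * (R - u x)) := by
    refine LipschitzWith.of_dist_le_mul fun x y => ?_
    have h2 := hK.dist_le_mul x y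
    rw [Real.dist_eq] at h2 ⊢
    rw [show 1 + ((j : ℝ) + 1) * (R - u x) - (1 + ((j : ℝ) + 1) * (R - u y)) =
      -(((j : ℝ) + 1) * (u x - u y)) by ring, abs_neg, abs_mul,
      abs_of_nonneg (by positivity : (0 : ℝ) ≤ (j : ℝ) + 1)]
    push_cast
    rw [mul_assoc]
    exact mul_le_mul_of_nonneg_left h2 (by positivity)
  refine exists_isTest ((h1.min_const 1).const_max 0) ?_
  rw [hasCompactSupport_iff_eventuallyEq, coclosedCompact_eq_cocompact]
  filter_upwards [ht.eventually_ge_atTop (R + 1)] with x hx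
  refine ramp_of_ge ?_
  have : (0 : ℝ) ≤ j := Nat.cast_nonneg j
  nlinarith

/-- A ramp is a nonincreasing function of `u`, so a field aligned with `u` is aligned with the ramp
up to sign. -/
lemma mul_ramp_sub {ζ a b R : ℝ} (h : ζ * (a - b) = |a - b|) {ν : ℝ} (hν : 0 ≤ ν) :
    ζ * (max 0 (min (1 + ν * (R - a)) 1) - max 0 (min (1 + ν * (R - b)) 1)) =
      -|max 0 (min (1 + ν * (R - a)) 1) - max 0 (min (1 + ν * (R - b)) 1)| := by
  have mono : ∀ {a b : ℝ}, a ≤ b → max 0 (min (1 + ν * (R - b)) 1) ≤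
      max 0 (min (1 + ν * (R - a)) 1) := fun {a b} hab => by
    have : ν * (R - b) ≤ ν * (R - a) := mul_le_mul_of_nonneg_left (by linarith) hν
    exact max_le_max_left _ (min_le_min_right _ (by linarith))
  rcases lt_trichotomy a b with hab | hab | hab
  · have h1 : ζ = -1 := by
      rw [abs_of_neg (by linarith)] at h
      exact mul_right_cancel₀ (by linarith : a - b ≠ 0) (by linarith)
    rw [h1, abs_of_nonneg (sub_nonneg.2 (mono hab.le))]; ring
  · rw [hab]; simp
  · have h1 : ζ = 1 := by
      rw [abs_of_pos (by linarith)] at h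
      exact mul_right_cancel₀ (by linarith : a - b ≠ 0) (by linarith)
    rw [h1, abs_of_nonpos (sub_nonpos.2 (mono hab.le))]; ring

lemma CalibratedSol.continuous (hu : CalibratedSol s h B u z) : Continuous u :=
  hu.lipschitz.continuous

lemma CalibratedSol.measurableSet_sublevel (hu : CalibratedSol s h B u z) (R : ℝ) :
    MeasurableSet {x | u x ≤ R} := measurableSet_le hu.continuous.measurable measurable_const

lemma CalibratedSol.sublevel_subset (hu : CalibratedSol s h B u z) (R : ℝ) :
    {x | u x ≤ R} ⊆ Metric.closedBall 0 R := fun x hx =>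
  mem_closedBall_zero_iff.2 ((hu.ge x).trans hx)

lemma CalibratedSol.integrableOn_sublevel (hu : CalibratedSol s h B u z) (R : ℝ)
    {f : Euc N → ℝ} (hf : Continuous f) : IntegrableOn f {x | u x ≤ R} :=
  (hf.continuousOn.integrableOn_compact (isCompact_closedBall (0 : Euc N) R)).mono_set
    (hu.sublevel_subset R)

/-- The perimeter of the sublevel sets is bounded by the divergence of the calibration. -/
lemma CalibratedSol.perimeter_sublevel_le (hN : 1 ≤ N) (hs0 : 0 < s) (hs1 : s < 1) (hh : 0 < h)
    (hu : CalibratedSol s h B u z) (R : ℝ) :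
    perimeter s {x | u x ≤ R} ≤ ENNReal.ofReal (1 / h * ∫ x in {x | u x ≤ R}, (u x - ‖x‖)) := by
  have hc := cs_pos (N := N) hs1
  have hm := hu.measurableSet_sublevel R
  have hucont := hu.continuous
  choose C ρ ht using exists_isTest_ramp hu.weakSol.mem R
  -- Alignment turns the weak equation into an exact formula for the fractional total variation of
  -- each ramp.
  have hJ : ∀ j, ∫ p, |dq s (ramp u R j) p| =
      2 / (h * cs N s) * ∫ x, (u x - ‖x‖) * ramp u R j x := by
    intro j
    have h1 := hu.weak _ _ _ (ht j)
    have h2 : ∫ p, z p * dq s (ramp u R j) p = - ∫ p, |dq s (ramp u R j) p| := by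
      rw [← integral_neg]
      refine integral_congr_ae ?_
      filter_upwards [hu.align] with p hp
      simp only [dq_eq]
      rw [abs_mul, abs_of_nonneg (ker_nonneg _), ← mul_assoc]
      unfold ramp
      rw [mul_ramp_sub hp (by positivity)]
      ring
    have h3 : ∫ x, (u x - ‖x‖) * ramp u R j x =
        (∫ x, u x * ramp u R j x) - ∫ x, ‖x‖ * ramp u R j x := by
      simp_rw [sub_mul]
      exact integral_sub ((ht j).integrable_mul hN hucont)
        ((ht j).integrable_mul hN continuous_norm)
    rw [h2] at h1
    rw [h3, div_mul_eq_mul_div, eq_div_iff (by positivity)]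
    linarith
  set L := ∫ x in {x | u x ≤ R}, (u x - ‖x‖) with hL
  have hlim : Tendsto (fun j => ∫ x, (u x - ‖x‖) * ramp u R j x) atTop (𝓝 L) := by
    rw [hL, ← integral_indicator hm]
    refine tendsto_integral_of_dominated_convergence
      ((Metric.closedBall (0 : Euc N) (R + 1)).indicator fun x => |u x - ‖x‖|)
      (fun j => ((hucont.sub continuous_norm).mul
        ((ht j).continuous hN)).aestronglyMeasurable) ?_ (fun j => ae_of_all _ fun x => ?_)
      (ae_of_all _ fun x => ?_)
    · rw [integrable_indicator_iff measurableSet_closedBall]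
      exact (hucont.sub continuous_norm).abs.continuousOn.integrableOn_compact
        (isCompact_closedBall _ _)
    · rw [norm_mul, Real.norm_eq_abs, Real.norm_of_nonneg (ramp_nonneg j x)]
      by_cases hx : x ∈ Metric.closedBall (0 : Euc N) (R + 1)
      · rw [Set.indicator_of_mem hx]
        exact mul_le_of_le_one_right (abs_nonneg _) (ramp_le_one j x)
      · rw [Set.indicator_of_notMem hx, ramp_of_ge, mul_zero]
        have h1 : R + 1 < ‖x‖ := by simpa using hx
        have h2 := hu.ge x
        have : (0 : ℝ) ≤ j := Nat.cast_nonneg j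
        nlinarith
    · have h1 := (tendsto_ramp (u := u) (R := R) x).const_mul (u x - ‖x‖)
      by_cases hx : x ∈ {x | u x ≤ R}
      · rw [Set.indicator_of_mem hx] at h1 ⊢
        simpa using h1
      · rw [Set.indicator_of_notMem hx] at h1 ⊢
        simpa using h1
  -- The ramps have no common integrable majorant at hand; Fatou's lemma gives the needed inequality
  -- and shows that the perimeter is finite.
  have hfatou : ∫⁻ p : Euc N × Euc N, ENNReal.ofReal (jump s {x | u x ≤ R} p) ≤
      ENNReal.ofReal (2 / (h * cs N s) * L) := by
    have h1 : ∀ p : Euc N × Euc N, Tendsto (fun j => ENNReal.ofReal |dq s (ramp u R j) p|) atTop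
        (𝓝 (ENNReal.ofReal (jump s {x | u x ≤ R} p))) := by
      intro p
      refine (ENNReal.continuous_ofReal.tendsto _).comp ?_
      simp_rw [dq_eq, abs_mul, abs_of_nonneg (ker_nonneg (s := s) (p.1 - p.2))]
      exact ((tendsto_ramp p.1).sub (tendsto_ramp p.2)).abs.mul_const _
    have h2 : ∀ j, ∫⁻ p, ENNReal.ofReal |dq s (ramp u R j) p| =
        ENNReal.ofReal (2 / (h * cs N s) * ∫ x, (u x - ‖x‖) * ramp u R j x) := by
      intro j
      rw [← hJ, ofReal_integral_eq_lintegral_ofReal ((ht j).integrable_dq hN hs0 hs1).abs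
        (ae_of_all _ fun p => abs_nonneg _)]
    calc ∫⁻ p : Euc N × Euc N, ENNReal.ofReal (jump s {x | u x ≤ R} p)
        = ∫⁻ p : Euc N × Euc N, liminf (fun j => ENNReal.ofReal |dq s (ramp u R j) p|) atTop :=
          lintegral_congr fun p => (h1 p).liminf_eq.symm
      _ ≤ liminf (fun j => ∫⁻ p, ENNReal.ofReal |dq s (ramp u R j) p|) atTop :=
          lintegral_liminf_le fun j =>
            (measurable_dq ((ht j).continuous hN).measurable).abs.ennreal_ofReal
      _ = _ := by
          simp_rw [h2]
          exact ((ENNReal.continuous_ofReal.tendsto _).comp (hlim.const_mul _)).liminf_eq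
  rw [perimeter_eq hs1 hm]
  refine (mul_le_mul_right hfatou _).trans ?_
  rw [← ENNReal.ofReal_mul (by positivity)]
  refine ENNReal.ofReal_le_ofReal (le_of_eq ?_)
  field_simp

/-- The sublevel sets of the solution are the maximal minimizers. -/
lemma CalibratedSol.isMaximalSolution (hN : 1 ≤ N) (hs0 : 0 < s) (hs1 : s < 1) (hh : 0 < h)
    (hu : CalibratedSol s h B u z) (R : ℝ) : IsMaximalSolution s h R {x | u x ≤ R} := by
  set T : Set (Euc N) := {x | u x ≤ R} with hT
  have hTm : MeasurableSet T := hu.measurableSet_sublevel R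
  have hucont := hu.continuous
  have hh' : 0 < 1 / h := by positivity
  have hPle := hu.perimeter_sublevel_le hN hs0 hs1 hh R
  have hPT : perimeter s T ≠ ⊤ := ne_top_of_le_ne_top ENNReal.ofReal_ne_top hPle
  have hfc : Continuous fun x => u x - R := by fun_prop
  have hTi : IntegrableOn (fun x => u x - R) T := hu.integrableOn_sublevel R hfc
  have hET : ballEnergy s h R T ≤ ((1 / h * ∫ x in T, (u x - R) : ℝ) : EReal) := by
    have i1 : IntegrableOn (fun x => ‖x‖ - R) T := hu.integrableOn_sublevel R (by fun_prop)
    have i2 : IntegrableOn (fun x => u x - ‖x‖) T := hu.integrableOn_sublevel R (by fun_prop)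
    rw [ballEnergy_eq_coe hPT i1, EReal.coe_le_coe_iff]
    have h0 : 0 ≤ ∫ x in T, (u x - ‖x‖) := integral_nonneg fun x => by
      simpa using hu.ge x
    have h1 : (perimeter s T).toReal ≤ 1 / h * ∫ x in T, (u x - ‖x‖) :=
      ENNReal.toReal_le_of_le_ofReal (by positivity) hPle
    have h2 : ∫ x in T, (u x - R) = (∫ x in T, (u x - ‖x‖)) + ∫ x in T, (‖x‖ - R) := by
      rw [← integral_add i2 i1]
      congr 1; ext x; ring
    rw [h2]; linarith
  have hlow : ∀ F : Set (Euc N), MeasurableSet F → ballEnergy s h R F = ⊤ ∨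
      (IntegrableOn (fun x => u x - R) F ∧
        ((1 / h * ∫ x in F, (u x - R) : ℝ) : EReal) ≤ ballEnergy s h R F) := by
    intro F hF
    rcases ballEnergy_eq_top_or (s := s) (R := R) hh hF with h1 | ⟨hP, hv, i1⟩
    · exact Or.inl h1
    · right
      have i2 : IntegrableOn (fun x => u x - ‖x‖) F := by
        refine Measure.integrableOn_of_bounded (M := B) hv
          (by fun_prop) (ae_of_all _ fun x => ?_)
        have := hu.ge x
        have := hu.le x
        rw [Real.norm_of_nonneg (by linarith)]; linarith
      have e : (fun x => u x - R) = fun x => (u x - ‖x‖) + (‖x‖ - R) := by ext x; ring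
      refine ⟨by rw [e]; exact i2.add i1, ?_⟩
      rw [ballEnergy_eq_coe hP i1, EReal.coe_le_coe_iff]
      have h2 := hu.calib F hF hv hP
      have h3 : ∫ x in F, (u x - R) = (∫ x in F, (u x - ‖x‖)) + ∫ x in F, (‖x‖ - R) := by
        rw [e]; exact integral_add i2 i1
      rw [h3, mul_add]
      have h4 := mul_le_mul_of_nonneg_left h2 hh'.le
      rw [← mul_assoc, one_div, inv_mul_cancel₀ hh.ne', one_mul] at h4
      rw [one_div]
      linarith
  -- `T` is exactly where `u - R ≤ 0`, so it minimizes `∫_F (u - R)` pointwise in the integrand.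
  have hind : ∀ (F : Set (Euc N)) (x : Euc N), T.indicator (fun x => u x - R) x ≤
      F.indicator (fun x => u x - R) x := by
    intro F x
    by_cases hxT : x ∈ T
    · rw [Set.indicator_of_mem hxT]
      have h1 : u x ≤ R := hxT
      by_cases hxF : x ∈ F
      · rw [Set.indicator_of_mem hxF]
      · rw [Set.indicator_of_notMem hxF]; linarith
    · rw [Set.indicator_of_notMem hxT]
      have h1 : R < u x := not_le.1 hxT
      by_cases hxF : x ∈ F
      · rw [Set.indicator_of_mem hxF]; linarith
      · rw [Set.indicator_of_notMem hxF]
  have hTind := (integrable_indicator_iff hTm).2 hTi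
  refine ⟨⟨hTm.nullMeasurableSet, fun G hG => ?_⟩, fun G hG => ?_⟩
  · obtain ⟨F, hFm, hFG⟩ : ∃ F, MeasurableSet F ∧ G =ᵐ[volume] F :=
      ⟨_, measurableSet_toMeasurable volume G, hG.toMeasurable_ae_eq.symm⟩
    rw [ballEnergy_congr hFG]
    rcases hlow F hFm with h1 | ⟨i, h1⟩
    · rw [h1]; exact le_top
    · refine hET.trans (le_trans ?_ h1)
      rw [EReal.coe_le_coe_iff]
      refine mul_le_mul_of_nonneg_left ?_ hh'.le
      rw [← integral_indicator hTm, ← integral_indicator hFm]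
      exact integral_mono hTind ((integrable_indicator_iff hFm).2 i) (hind F)
  · obtain ⟨F, hFm, hFG⟩ : ∃ F, MeasurableSet F ∧ G =ᵐ[volume] F :=
      ⟨_, measurableSet_toMeasurable volume G, hG.1.toMeasurable_ae_eq.symm⟩
    have h2 : ballEnergy s h R F ≤ ((1 / h * ∫ x in T, (u x - R) : ℝ) : EReal) := by
      rw [← ballEnergy_congr hFG]
      exact (hG.2 T hTm.nullMeasurableSet).trans hET
    rcases hlow F hFm with h1 | ⟨i, h1⟩
    · rw [h1] at h2
      exact absurd h2 (not_le.2 (EReal.coe_lt_top _))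
    · have h3 := h1.trans h2
      rw [EReal.coe_le_coe_iff, mul_le_mul_iff_right₀ hh', ← integral_indicator hTm,
        ← integral_indicator hFm] at h3
      have hFind := (integrable_indicator_iff hFm).2 i
      -- For another minimizer the two integrals agree, so the indicators agree almost everywhere.
      -- On `F \ T` this would force `u = R`, although `u > R` there.
      have h4 := (integral_eq_zero_iff_of_nonneg (fun x => sub_nonneg.2 (hind F x))
        (hFind.sub hTind)).1 (le_antisymm (by
          rw [integral_sub hFind hTind]; linarith)
          (integral_nonneg fun x => sub_nonneg.2 (hind F x)))
      have h5 : volume (F \ T) = 0 := by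
        rw [measure_eq_zero_iff_ae_notMem]
        filter_upwards [h4] with x hx hxF
        rw [Set.indicator_of_mem hxF.1, Set.indicator_of_notMem hxF.2] at hx
        have h6 : R < u x := not_le.1 hxF.2
        simp only [Pi.zero_apply] at hx
        linarith
      rw [← h5]
      exact measure_congr (hFG.diff (ae_eq_refl T))

lemma CalibratedSol.ae_eq_of_isMaximalSolution (hN : 1 ≤ N) (hs0 : 0 < s) (hs1 : s < 1)
    (hh : 0 < h) (hu : CalibratedSol s h B u z) {R : ℝ} {T : Set (Euc N)}
    (hT : IsMaximalSolution s h R T) : volume ({x | u x ≤ R} \ T) = 0 :=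
  hT.2 _ (hu.isMaximalSolution hN hs0 hs1 hh R).1

/-- All sufficiently small balls around `x` lie in `S`, hence in `T` up to a null set, so the
density ratio is eventually constant. -/
lemma mem_densityOne {S T : Set (Euc N)} {x : Euc N} (hS : S ∈ 𝓝 x) (h : volume (S \ T) = 0) :
    x ∈ densityOne T := by
  obtain ⟨r, hr, hball⟩ := Metric.mem_nhds_iff.1 hS
  have h1 : Tendsto (fun ρ : ℝ => volume (T ∩ Metric.ball x ρ) / volume (Metric.ball x ρ))
      (𝓝[>] 0) (𝓝 1) := by
    refine tendsto_const_nhds.congr' ?_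
    filter_upwards [Ioo_mem_nhdsGT hr] with ρ hρ
    have h2 : volume (Metric.ball x ρ \ T) = 0 :=
      measure_mono_null (t := S \ T) (fun y hy => ⟨hball (Metric.ball_subset_ball hρ.2.le hy.1), hy.2⟩) h
    have h3 : volume (T ∩ Metric.ball x ρ) = volume (Metric.ball x ρ) := by
      refine le_antisymm (measure_mono Set.inter_subset_right) ?_
      have : Metric.ball x ρ ⊆ (T ∩ Metric.ball x ρ) ∪ (Metric.ball x ρ \ T) := fun y hy => by
        by_cases hyT : y ∈ T
        · exact Or.inl ⟨hyT, hy⟩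
        · exact Or.inr ⟨hy, hyT⟩
      refine (measure_mono this).trans ((measure_union_le _ _).trans ?_)
      rw [h2, add_zero]
    rw [h3, ENNReal.div_self (Metric.measure_ball_pos _ _ hρ.1).ne' measure_ball_lt_top.ne]
  exact h1

end maximal

end FracFlow

/-! ### Assembly: choice of radii and of the time step -/

theorem lemma4p5 (N : ℕ) (hN : 1 ≤ N) (s : ℝ) (hs0 : 0 < s) (hs1 : s < 1) :
    -- `κ ρ` is the constant fractional curvature of the ball of radius `ρ`
    ∃ κ : ℝ → ℝ,
      (∀ ρ : ℝ, 0 < ρ → ∀ x : FracFlow.Euc N, ‖x‖ = ρ →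
        FracFlow.HasCurvature s (Metric.ball (0 : FracFlow.Euc N) ρ) x (κ ρ)) ∧
      (∀ δ : ℝ, 0 < δ → ∃ h₀ : ℝ, 0 < h₀ ∧ ∀ h : ℝ, 0 < h → h < h₀ →
        (∀ R : ℝ, δ ≤ R →
          (∃ T : Set (FracFlow.Euc N), FracFlow.IsMaximalSolution s h R T) ∧
          ∀ T : Set (FracFlow.Euc N), FracFlow.IsMaximalSolution s h R T →
            Metric.closedBall (0 : FracFlow.Euc N) (R - κ (δ / 2) * h) ⊆ FracFlow.densityOne T) ∧
        (∃ φ : FracFlow.Euc N → ℝ, FracFlow.IsROFSolution s h (fun x => ‖x‖) φ) ∧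
        ∀ φ : FracFlow.Euc N → ℝ, FracFlow.IsROFSolution s h (fun x => ‖x‖) φ →
          ∀ x : FracFlow.Euc N, δ ≤ ‖x‖ + κ (δ / 2) * h → φ x ≤ ‖x‖ + κ (δ / 2) * h) ∧
      (∀ α : ℝ, 0 < α → α < 1 / ((N : ℝ) + 1) →
        ∃ h₁ : ℝ, 0 < h₁ ∧ ∀ h : ℝ, 0 < h → h ≤ h₁ →
          (∃ φ : FracFlow.Euc N → ℝ, FracFlow.IsROFSolution s h (fun x => ‖x‖) φ) ∧
          ∀ φ : FracFlow.Euc N → ℝ, FracFlow.IsROFSolution s h (fun x => ‖x‖) φ →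
            φ 0 ≤ 2 * h ^ α) := by
  open FracFlow in
  have := euc_nontrivial hN
  obtain ⟨e, he⟩ := exists_norm_eq (Euc N) zero_le_one
  have he0 : e ≠ 0 := norm_pos_iff.1 (by rw [he]; exact one_pos)
  have hc := cs_pos (N := N) hs1
  have hnorm : ∀ t : ℝ, 0 < t → ‖t • e‖ = t := fun t ht => by
    rw [norm_smul, he, mul_one, Real.norm_of_nonneg ht.le]
  have hne : ∀ t : ℝ, 0 < t → t • e ≠ 0 := fun t ht => smul_ne_zero ht.ne' he0
  refine ⟨fun ρ => cs N s * curv s (ρ • e), ?_, ?_, ?_⟩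
  · rintro ρ hρ x rfl
    have hx : x ≠ 0 := norm_pos_iff.1 hρ
    simp only
    rw [curv_congr (hnorm _ hρ)]
    exact hasCurvature_ball hN hs0 hs1 hx
  · intro δ hδ
    set κ₁ := cs N s * curv s ((δ / 2) • e) with hκ₁
    -- The comparison uses radius `5δ/8 > δ/2`: the gap `κ₂ < κ₁` yields strict inequalities, and
    -- `5δ/8 + δ/8 = 3δ/4` is the level `a` of the supersolution.
    set κ₂ := cs N s * curv s ((5 * δ / 8) • e) with hκ₂
    have hκpos : 0 < κ₁ := mul_pos hc (curv_pos hN hs0 hs1 (hne _ (by positivity)))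
    have hκlt : κ₂ < κ₁ := by
      rw [hκ₁, hκ₂, curv_smul (by positivity), curv_smul (by positivity)]
      refine mul_lt_mul_of_pos_left (mul_lt_mul_of_pos_right ?_ (curv_pos hN hs0 hs1 he0)) hc
      exact Real.rpow_lt_rpow_of_neg (by positivity) (by linarith) (by linarith)
    obtain ⟨A, hA0, hA⟩ := WeakSol.apply_zero_le (N := N) hN hs0 hs1
    set r := min 1 (δ / 32) with hr
    have hr0 : 0 < r := lt_min one_pos (by positivity)
    -- The first bound on `h` gives `A h / r ≤ δ/16`, which with `2r ≤ δ/16` makes `u 0 ≤ δ/8`; `A +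
    -- 1` avoids dividing by zero. The second gives `κ₁ h ≤ δ/4`.
    refine ⟨min (r * δ / (16 * (A + 1))) (δ / (4 * κ₁)), by positivity, fun h hh hh0 => ?_⟩
    have hh1 : A * h / r ≤ δ / 16 := by
      have h1 := hh0.le.trans (min_le_left _ _)
      rw [le_div_iff₀ (by positivity)] at h1
      rw [div_le_iff₀ hr0]
      nlinarith
    have hh2 : κ₁ * h ≤ δ / 4 := by
      have h1 := hh0.le.trans (min_le_right _ _)
      rw [le_div_iff₀ (by positivity)] at h1
      linarith
    have hκh : κ₂ * h < κ₁ * h := mul_lt_mul_of_pos_right hκlt hh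
    have hbound : ∀ (B : ℝ) (u : Euc N → ℝ) (z : Euc N × Euc N → ℝ), CalibratedSol s h B u z →
        ∀ x, u x ≤ κ₂ * h + max ‖x‖ (3 * δ / 4) := by
      intro B u z hu x
      have h0 : u 0 ≤ δ / 8 := by
        have h1 := hA h r hh hr0 (min_le_left _ _) u z hu.weakSol
        have h2 : r ≤ δ / 32 := min_le_right _ _
        linarith
      refine hu.weakSol.le_max hN hs0 hs1 hh (hne (5 * δ / 8) (by positivity)) (d := δ / 8)
        (fun y => ?_) ?_ ?_ x
      · have := hu.lip y 0
        rw [sub_zero] at this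
        linarith
      · rw [hnorm _ (by positivity)]; linarith
      · rw [mul_comm]
    refine ⟨fun R hR => ?_, exists_isROFSolution hN hs0 hs1 hh, fun φ hφ x hx => ?_⟩
    · obtain ⟨B, u, z, hu⟩ := exists_calibratedSol (N := N) hN hs0 hs1 hh
      refine ⟨⟨_, hu.isMaximalSolution hN hs0 hs1 hh R⟩, fun T hT x hx => ?_⟩
      have hx' := mem_closedBall_zero_iff.1 hx
      refine mem_densityOne ?_ (hu.ae_eq_of_isMaximalSolution hN hs0 hs1 hh hT)
      -- If `‖x‖ ≥ 3δ/4` the gap `κ₂ < κ₁` gives strictness; otherwise `3δ/4 + κ₂ h < δ ≤ R`. By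
      -- continuity the sublevel set is then a neighbourhood of `x`.
      have h1 : u x < R := by
        refine (hbound B u z hu x).trans_lt ?_
        rcases max_cases ‖x‖ (3 * δ / 4) with ⟨h2, -⟩ | ⟨h2, -⟩ <;> rw [h2] <;> linarith
      filter_upwards [hu.continuous.continuousAt.eventually_lt_const h1] with y hy
      exact hy.le
    · obtain ⟨z, hz⟩ := (isROFSolution_iff hN hs0 hs1).1 hφ
      obtain ⟨B, z', hu⟩ := hz.exists_calibratedSol hN hs0 hs1 hh
      have h1 := hbound B φ z' hu x
      -- Here `‖x‖ ≥ δ - κ₁ h ≥ 3δ/4`, so the maximum is `‖x‖`.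
      rw [max_eq_left (by linarith)] at h1
      linarith
  · intro α hα hα'
    have hN' : (1 : ℝ) ≤ N := by exact_mod_cast hN
    have hα2 : α < 1 / 2 :=
      hα'.trans_le (one_div_le_one_div_of_le two_pos (by linarith))
    obtain ⟨h₁, hh₁, hb⟩ := WeakSol.apply_zero_le_rpow (N := N) hN hs0 hs1 hα hα2
    refine ⟨h₁, hh₁, fun h hh hh1 => ⟨exists_isROFSolution hN hs0 hs1 hh, fun φ hφ => ?_⟩⟩
    obtain ⟨z, hz⟩ := (isROFSolution_iff hN hs0 hs1).1 hφ
    exact hb h hh hh1 φ z hz
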